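/- Let $G$ be a finite simple graph. A path decomposition of $G$ is a finite sequence of sets of vertices (bags) such that every vertex lies in some bag, the two ends of every edge lie together in some bag, and the bags containing a given vertex are consecutive. A tree decomposition of $G$ is a finite forest whose nodes carry sets of vertices (bags) such that the two ends of every edge lie together in some bag and, for every vertex $v$, the set of nodes whose bags contain $v$ is nonempty and connected in the forest. The width of a decomposition is the maximum size of a bag minus one (and $0$ if all bags are empty), and the pathwidth $\mathrm{pw}(G)$ is the minimum width of a path decomposition of $G$. A guidance system over $G$ is a family $\Lambda$ of in-trees in $G$, an in-tree being a subgraph of $G$ that is a tree, with its edges oriented towards a distinguished root vertex. For a vertex $v$, let $\Lambda(v)$ be the set of roots of the trees of $\Lambda$ that contain $v$. A set $X$ of vertices is captured by $\Lambda$ if $X\subseteq\Lambda(v)$ for some vertex $v$ of $G$. The system $\Lambda$ is $k$-colorable if its trees can be colored with $k$ colors so that any two distinct trees sharing a vertex get different colors. The guided treewidth $\mathrm{gtw}(G)$ is the least $k$ such that $G$ has a tree decomposition all of whose bags are captured by a single $k$-colorable guidance system over $G$. **Lemma.** Guided treewidth is bounded by a function of pathwidth: there is a function $f:\mathbb N\to\mathbb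 N$ such that for every $k\in\mathbb N$ and every finite simple graph $G$ with $\mathrm{pw}(G)\le k$ one has $\mathrm{gtw}(G)\le f(k)$; moreover, $G$ has a tree decomposition of width at most $f(k)$ all of whose bags are captured by a single $f(k)$-colorable guidance system over $G$. -/

import Mathlib

namespace GuidedTW

universe u

/-- A path decomposition: a finite sequence of bags such that every vertex occurs in some bag,
both ends of every edge occur together in some bag, and the bags containing a given vertex are
consecutive. -/
structure PathDecomposition {V : Type u} (G : SimpleGraph V) where
  /-- number of bags -/
  length : ℕ
  bag : Fin length → Finset V
  vertex_mem : ∀ v : V, ∃ i, v ∈ bag i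
  edge_mem : ∀ v w : V, G.Adj v w → ∃ i, v ∈ bag i ∧ w ∈ bag i
  interval : ∀ (i j l : Fin length) (v : V), i ≤ j → j ≤ l → v ∈ bag i → v ∈ bag l → v ∈ bag j

/-- A tree decomposition over a finite forest of nodes: every edge is contained in some bag, and
for every vertex the set of nodes whose bags contain it is nonempty and connected in the forest. -/
structure TreeDecomposition {V : Type u} (G : SimpleGraph V) where
  Node : Type
  [fintypeNode : Fintype Node]
  forest : SimpleGraph Node
  isAcyclic : forest.IsAcyclic
  bag : Node → Finset V
  connected : ∀ v : V, (forest.induce {x | v ∈ bag x}).Connected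
  edge_mem : ∀ v w : V, G.Adj v w → ∃ x, v ∈ bag x ∧ w ∈ bag x

attribute [instance] TreeDecomposition.fintypeNode

/-- The width of a path decomposition: maximum bag size minus one (`0` if all bags are empty). -/
def PathDecomposition.width {V : Type u} {G : SimpleGraph V} (P : PathDecomposition G) : ℕ :=
  (Finset.univ.sup fun i => (P.bag i).card) - 1

/-- The width of a tree decomposition: maximum bag size minus one (`0` if all bags are empty). -/
def TreeDecomposition.width {V : Type u} {G : SimpleGraph V} (T : TreeDecomposition G) : ℕ :=
  (Finset.univ.sup fun x => (T.bag x).card) - 1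

/-- The pathwidth: minimum width of a path decomposition. -/
noncomputable def pathwidth {V : Type u} (G : SimpleGraph V) : ℕ∞ :=
  ⨅ P : PathDecomposition G, (P.width : ℕ∞)

/-- An in-tree in `G`: a subgraph of `G` that is a tree, with a distinguished root. (All edges are
oriented towards the root, so the orientation is determined by the root.) -/
structure InTree {V : Type u} (G : SimpleGraph V) where
  tree : G.Subgraph
  isTree : tree.coe.IsTree
  root : V
  root_mem : root ∈ tree.verts

/-- A guidance system over `G`: a family of in-trees in `G`. -/
abbrev GuidanceSystem {V : Type u} (G : SimpleGraph V) := Set (InTree G)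

namespace GuidanceSystem

variable {V : Type u} {G : SimpleGraph V}

/-- `Λ.targets v` is `Λ(v)`: the set of roots of those trees of `Λ` that contain `v`. -/
def targets (Λ : GuidanceSystem G) (v : V) : Set V :=
  {w | ∃ t ∈ Λ, v ∈ t.tree.verts ∧ t.root = w}

/-- `Λ` captures the set `X` if `X ⊆ Λ(v)` for some vertex `v`. -/
def Captures (Λ : GuidanceSystem G) (X : Finset V) : Prop :=
  ∃ v : V, (X : Set V) ⊆ Λ.targets v

/-- `Λ` is `k`-colorable if its trees can be colored with `k` colors so that any two different
trees that share a vertex receive different colors. -/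
def Colorable (Λ : GuidanceSystem G) (k : ℕ) : Prop :=
  ∃ c : Λ → Fin k, ∀ s t : Λ, s ≠ t →
    (s.1.tree.verts ∩ t.1.tree.verts).Nonempty → c s ≠ c t

end GuidanceSystem

/-- The guided treewidth: the least `k` such that `G` has a tree decomposition all of whose bags
are captured by one `k`-colorable guidance system over `G`. -/
noncomputable def guidedTreewidth {V : Type u} (G : SimpleGraph V) : ℕ∞ :=
  ⨅ k ∈ {k : ℕ | ∃ (T : TreeDecomposition G) (Λ : GuidanceSystem G),
    Λ.Colorable k ∧ ∀ x, Λ.Captures (T.bag x)}, (k : ℕ∞)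

end GuidedTW

/-! Cut a path decomposition into intervals of bags and build guided schemes for the vertices
strictly inside each interval, along a factorization forest in the sense of Simon. To every interval
attach a type in a finite semigroup: how the vertices of its left bag, and those of its right bag,
are connected inside the interval, while avoiding an arbitrary set of labels, and which labels
belong to vertices present in both end bags. Since a middle bag separates its two sides, types
multiply under concatenation (`connType_additive`). Over a finite semigroup every interval is
assembled from single steps in boundedly many rounds, each round joining two intervals or a whole
chain of intervals of one idempotent type (`FactorizationClosed.bounded`). It remains to pay
boundedly many new colors per round.

Joining two intervals adds at most one bag of vertices, eliminated last, each guided by the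
component containing it (`GuidedElim.add_bounded`). In an idempotent chain all subchains have the
same type. Persistent vertices lie in the outer bags, hence not in the interior, and every other
vertex lies on at most one cut. Equality of types lets a path that wanders far from a cut be
rerouted within the neighboring intervals (`Homogeneous.local_conn`). So a cut vertex needs a
guiding tree only in a bounded window, and colors can be reused periodically along the chain
(`GuidedElim.glue_linear`). The two extreme cuts are then added by `GuidedElim.add_bounded`.

Schemes are kept as elimination orders with guiding relations. Only at the end are these converted
to a forest of bags and to in-trees (`GuidedElim.exists_treeDecomposition`). A captured bag meets
each color at most once, so the number of colors also bounds the width. -/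

namespace GuidedTW

open Relation

/-! ### Factorization forests over finite semigroups -/

/-- A labelling of the pairs `i < j` by elements of a semigroup is additive if the label of a
concatenation is the product of the labels. -/
def Additive {S : Type*} [Mul S] (c : ℕ → ℕ → S) : Prop :=
  ∀ i j k, i < j → j < k → c i k = c i j * c j k

/-- A family of predicates on intervals closed under the operations of a factorization forest. -/
structure FactorizationClosed {S : Type*} [Mul S] (c : ℕ → ℕ → S) (P : ℕ → ℕ → ℕ → Prop) :
    Prop where
  lt : ∀ h i j, P h i j → i < j
  succ : ∀ h i j, P h i j → P (h + 1) i j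
  binary : ∀ h i j k, P h i j → P h j k → P (h + 1) i k
  idem : ∀ h e i j, e * e = e → TransGen (fun i j => P h i j ∧ c i j = e) i j → P (h + 1) i j

theorem FactorizationClosed.mono {S : Type*} [Mul S] {c : ℕ → ℕ → S} {P : ℕ → ℕ → ℕ → Prop}
    (hP : FactorizationClosed c P) {h h' i j : ℕ} (hh : h ≤ h') (H : P h i j) : P h' i j := by
  induction hh with
  | refl => exact H
  | step _ ih => exact hP.succ _ _ _ ih

/-- Cut the chain before every `Qa`-step: what remains is an optional initial run of `Qb`-steps,
then blocks made of one `Qa`-step and a possibly empty run of `Qb`-steps. -/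
theorem transGen_split_or {α : Type*} {Qa Qb : α → α → Prop} {i j : α}
    (h : TransGen (fun i j => Qa i j ∨ Qb i j) i j) :
    TransGen Qb i j ∨ ∃ k, (i = k ∨ TransGen Qb i k) ∧
      TransGen (fun i j => Qa i j ∨ ∃ k, Qa i k ∧ TransGen Qb k j) k j := by
  induction h with
  | single h =>
    rcases h with h | h
    · exact .inr ⟨i, .inl rfl, .single (.inl h)⟩
    · exact .inl (.single h)
  | tail _ h ih =>
    rcases h with h | h
    · rcases ih with ih | ⟨k, hk, ih⟩
      · exact .inr ⟨_, .inr ih, .single (.inl h)⟩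
      · exact .inr ⟨k, hk, ih.tail (.inl h)⟩
    · rcases ih with ih | ⟨k, hk, ih⟩
      · exact .inl (ih.tail h)
      · refine .inr ⟨k, hk, ?_⟩
        have key : ∀ {a b d}, (Qa a b ∨ ∃ k, Qa a k ∧ TransGen Qb k b) → Qb b d →
            (Qa a d ∨ ∃ k, Qa a k ∧ TransGen Qb k d) := by
          rintro a b d (h1 | ⟨m, h1, h2⟩) h3
          · exact .inr ⟨b, h1, .single h3⟩
          · exact .inr ⟨m, h1, h2.tail h3⟩
        cases ih with
        | single h' => exact .single (key h' h)
        | tail h1 h' => exact h1.tail (key h' h)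

theorem transGen_pair_steps {α : Type*} {Z : α → α → Prop} {i j : α} (h : TransGen Z i j) :
    ∃ k, (i = k ∨ TransGen (fun i j => ∃ m, Z i m ∧ Z m j) i k) ∧ (k = j ∨ Z k j) := by
  induction h with
  | single h => exact ⟨i, .inl rfl, .inr h⟩
  | tail _ h ih =>
    obtain ⟨k, hk, rfl | hz⟩ := ih
    · exact ⟨k, hk, .inr h⟩
    · refine ⟨_, .inr ?_, .inl rfl⟩
      rcases hk with rfl | hk
      · exact .single ⟨_, hz, h⟩
      · exact hk.tail ⟨_, hz, h⟩

/-- `ChainThrough Q W i j`: a nonempty chain of `Q`-steps all of whose interior points lie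
in `W`. -/
def ChainThrough {α : Type*} (Q : α → α → Prop) (W : Set α) (i j : α) : Prop :=
  ∃ k, ReflTransGen (fun a b => Q a b ∧ b ∈ W) i k ∧ Q k j

theorem ChainThrough.tail {α : Type*} {Q : α → α → Prop} {W : Set α} {i j k : α}
    (h : ChainThrough Q W i j) (hj : j ∈ W) (hq : Q j k) : ChainThrough Q W i k := by
  obtain ⟨m, h1, h2⟩ := h
  exact ⟨j, h1.tail ⟨h2, hj⟩, hq⟩

theorem ChainThrough.transGen {α : Type*} {Q : α → α → Prop} {W : Set α} {i j : α}
    (h : ChainThrough Q W i j) : TransGen Q i j := by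
  obtain ⟨m, h1, h2⟩ := h
  exact TransGen.tail' (ReflTransGen.mono (fun _ _ h => h.1) _ _ h1) h2

/-- Cut the chain at all its visits to `Y`; `k` and `l` are the first and the last such visit. -/
theorem ChainThrough.split {α : Type*} {Q : α → α → Prop} {W Y : Set α} {i j : α}
    (h : ChainThrough Q (W ∪ Y) i j) :
    ChainThrough Q W i j ∨ ∃ k l, ChainThrough Q W i k ∧ k ∈ Y ∧
      ReflTransGen (fun a b => ChainThrough Q W a b ∧ a ∈ Y ∧ b ∈ Y) k l ∧
      l ∈ Y ∧ ChainThrough Q W l j := by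
  obtain ⟨m, h1, h2⟩ := h
  induction h1 generalizing j with
  | refl => exact .inl ⟨i, .refl, h2⟩
  | tail _ h ih =>
    rcases ih h.1 with ih | ⟨k, l, h3, hk, h4, hl, h5⟩
    · rcases h.2 with hW | hY
      · exact .inl (ih.tail hW h2)
      · exact .inr ⟨_, _, ih, hY, .refl, hY, _, .refl, h2⟩
    · rcases h.2 with hW | hY
      · exact .inr ⟨k, l, h3, hk, h4, hl, h5.tail hW h2⟩
      · exact .inr ⟨k, _, h3, hk, h4.tail ⟨h5, hl, hY⟩, hY, _, .refl, h2⟩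

/-- The cancellative case, by induction on the set `W` of prefix values `c o k` allowed at interior
points. Values between two points with the same prefix value `g` fix `g` on the right, so left
cancellation makes them all equal to one idempotent. Allowing one more prefix value thus costs one
idempotent round and two binary rounds, hence the `N + 3`. -/
theorem FactorizationClosed.of_cancel_aux {S : Type*} [Semigroup S] {T : Set S} (W : Finset S) :
    ∃ N : ℕ, ∀ (c : ℕ → ℕ → S) (P : ℕ → ℕ → ℕ → Prop), Additive c → FactorizationClosed c P →
      ∀ (Q : ℕ → ℕ → Prop) (h o : ℕ), (∀ i j, Q i j → P h i j) →
      (∀ i j, TransGen Q i j → i < j ∧ c i j ∈ T ∧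
        ∀ x ∈ T, ∀ y ∈ T, c i j * x = c i j * y → x = y) →
      (∀ x ∈ T, ∀ y ∈ T, x * y ∈ T) →
      ∀ i j, ReflTransGen Q o i → ChainThrough Q {k | c o k ∈ W} i j → P (h + N) i j := by
  classical
  induction W using Finset.induction_on with
  | empty =>
    refine ⟨0, fun c P hc hP Q h o hQ hT hmul i j hi hch => ?_⟩
    obtain ⟨m, h1, h2⟩ := hch
    rcases ReflTransGen.cases_tail h1 with rfl | ⟨b, -, -, hb⟩
    · exact hQ _ _ h2
    · simp at hb
  | insert g W hg ih =>
    obtain ⟨N, ih⟩ := ih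
    refine ⟨N + 3, fun c P hc hP Q h o hQ hT hmul i j hi hch => ?_⟩
    have ih := ih c P hc hP Q h o hQ hT hmul
    have hset : {k | c o k ∈ insert g W} = {k | c o k ∈ W} ∪ {k | c o k = g} := by
      ext k; simp [or_comm]
    rw [hset] at hch
    rcases hch.split with h1 | ⟨k, l, h1, hk, h2, hl, h3⟩
    · exact hP.mono (by omega) (ih _ _ hi h1)
    · have hok : TransGen Q o k := TransGen.trans_right hi h1.transGen
      have hkl : ReflTransGen Q k l := by
        clear h3 hl
        induction h2 with
        | refl => exact .refl
        | tail _ h ih => exact ih.trans h.1.transGen.to_reflTransGen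
      have hPik : P (h + N) i k := ih _ _ hi h1
      have hPlj : P (h + N) l j := ih _ _ (hok.to_reflTransGen.trans hkl) h3
      rcases eq_or_ne k l with rfl | hne
      · exact hP.mono (by omega) (hP.binary _ _ _ _ hPik hPlj)
      have hfix : ∀ a b, TransGen Q o a → c o a = g → TransGen Q a b → c o b = g →
          g * c a b = g := by
        intro a b ha hga hab hgb
        have := hc o a b (hT _ _ ha).1 (hT _ _ hab).1
        rw [hgb, hga] at this
        exact this.symm
      have hcanc := (hT _ _ hok).2.2
      have hck : c o k = g := hk
      rw [hck] at hcanc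
      have hkl' : TransGen Q k l := by
        rcases Relation.reflTransGen_iff_eq_or_transGen.1 hkl with h | h
        · exact absurd h.symm hne
        · exact h
      have he := hfix k l hok hk hkl' hl
      have heT := (hT _ _ hkl').2.1
      -- Cancel `g` from `g * (e * e) = g * e`, where `e = c k l`.
      have hidem : c k l * c k l = c k l :=
        hcanc _ (hmul _ heT _ heT) _ heT (by rw [← mul_assoc, he, he])
      have hchain : ReflTransGen (fun a b => P (h + N) a b ∧ c a b = c k l) k l ∧
          TransGen Q o l := by
        have : ∀ b, ReflTransGen (fun a b => ChainThrough Q {k | c o k ∈ W} a b ∧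
            a ∈ {k | c o k = g} ∧ b ∈ {k | c o k = g}) k b →
            ReflTransGen (fun a b => P (h + N) a b ∧ c a b = c k l) k b ∧ TransGen Q o b := by
          intro b hb
          induction hb with
          | refl => exact ⟨.refl, hok⟩
          | tail _ hs ih' =>
            obtain ⟨h4, h5⟩ := ih'
            have hab := hs.1.transGen
            refine ⟨h4.tail ⟨ih _ _ h5.to_reflTransGen hs.1, ?_⟩, h5.trans hab⟩
            refine hcanc _ (hT _ _ hab).2.1 _ heT ?_
            rw [hfix _ _ h5 hs.2.1 hab hs.2.2, he]
        exact this l h2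
      have hPkl : P (h + N + 1) k l := by
        rcases Relation.reflTransGen_iff_eq_or_transGen.1 hchain.1 with h | h
        · exact absurd h.symm hne
        · exact hP.idem _ _ _ _ hidem h
      have := hP.binary _ _ _ _ (hP.binary _ _ _ _ (hP.mono (by omega) hPik) hPkl)
        (hP.mono (by omega) hPlj)
      exact hP.mono (by omega) this

/-- Double induction on the size of a subsemigroup `T` and of the set `A ⊆ T` of step values. If
every `a ∈ A` acts injectively on `T`, the cancellative case applies. Otherwise some `a` has `a T`
strictly smaller than `T`: group the chain into blocks starting with `a`, and products of two blocks
fall into the subsemigroup `a T`. -/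
theorem FactorizationClosed.bounded_aux {S : Type*} [Semigroup S] [Finite S] (n : ℕ) :
    ∀ (T : Set S), T.ncard ≤ n → (∀ x ∈ T, ∀ y ∈ T, x * y ∈ T) →
    ∀ (m : ℕ) (A : Set S), A.ncard ≤ m → A ⊆ T →
    ∃ N : ℕ, ∀ (c : ℕ → ℕ → S) (P : ℕ → ℕ → ℕ → Prop), Additive c → FactorizationClosed c P →
      ∀ (h i j : ℕ), TransGen (fun i j => P h i j ∧ c i j ∈ A) i j → P (h + N) i j := by
  induction n with
  | zero =>
    intro T hT _ m A _ hAT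
    refine ⟨0, fun c P _ _ h i j hch => ?_⟩
    have : T = ∅ := (Set.ncard_eq_zero (Set.toFinite T)).1 (by omega)
    obtain ⟨b, -, hb⟩ := TransGen.tail'_iff.1 hch
    exact absurd (hAT hb.2) (by simp [this])
  | succ n ihn =>
    intro T hTn hmul m
    induction m with
    | zero =>
      intro A hA _
      refine ⟨0, fun c P _ _ h i j hch => ?_⟩
      have : A = ∅ := (Set.ncard_eq_zero (Set.toFinite A)).1 (by omega)
      obtain ⟨b, -, hb⟩ := TransGen.tail'_iff.1 hch
      exact absurd hb.2 (by simp [this])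
    | succ m ihm =>
      intro A hA hAT
      have hval : ∀ {c : ℕ → ℕ → S} {P : ℕ → ℕ → ℕ → Prop}, Additive c →
          FactorizationClosed c P → ∀ {h : ℕ} {B : Set S}, B ⊆ T → ∀ {i j : ℕ},
          TransGen (fun i j => P h i j ∧ c i j ∈ B) i j → i < j ∧ c i j ∈ T := by
        intro c P hc hP h B hB i j hch
        induction hch with
        | single hs => exact ⟨hP.lt _ _ _ hs.1, hB hs.2⟩
        | tail _ hs ih =>
          have := hP.lt _ _ _ hs.1
          refine ⟨ih.1.trans this, ?_⟩
          rw [hc _ _ _ ih.1 this]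
          exact hmul _ ih.2 _ (hB hs.2)
      by_cases hcase : ∀ a ∈ A, (a * ·) '' T = T
      · have hinj : ∀ a ∈ A, ∀ x ∈ T, ∀ y ∈ T, a * x = a * y → x = y := by
          intro a ha
          have : Set.InjOn (a * ·) T := by
            apply (Set.ncard_image_iff (Set.toFinite T)).1
            rw [hcase a ha]
          intro x hx y hy hxy
          exact this hx hy hxy
        have := Fintype.ofFinite S
        obtain ⟨N, hN⟩ := FactorizationClosed.of_cancel_aux (T := T) (Finset.univ : Finset S)
        refine ⟨N, fun c P hc hP h i j hch => ?_⟩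
        refine hN c P hc hP (fun i j => P h i j ∧ c i j ∈ A) h i (fun _ _ h => h.1) ?_ hmul i j .refl ?_
        · intro i j hij
          refine ⟨(hval hc hP hAT hij).1, (hval hc hP hAT hij).2, ?_⟩
          induction hij with
          | single hs => exact hinj _ hs.2
          | tail h1 hs ih =>
            intro x hx y hy hxy
            have hT' := hAT hs.2
            rw [hc _ _ _ (hval hc hP hAT h1).1 (hP.lt _ _ _ hs.1), mul_assoc, mul_assoc] at hxy
            exact hinj _ hs.2 _ hx _ hy (ih _ (hmul _ hT' _ hx) _ (hmul _ hT' _ hy) hxy)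
        · obtain ⟨k, h1, h2⟩ := TransGen.tail'_iff.1 hch
          exact ⟨k, ReflTransGen.mono (fun _ _ h => ⟨h, by simp⟩) _ _ h1, h2⟩
      · push Not at hcase
        obtain ⟨a, ha, hne⟩ := hcase
        have haT := hAT ha
        have hsub : (a * ·) '' T ⊆ T := by
          rintro _ ⟨x, hx, rfl⟩
          exact hmul _ haT _ hx
        have hlt : ((a * ·) '' T).ncard < T.ncard :=
          Set.ncard_lt_ncard (hsub.ssubset_of_ne hne) (Set.toFinite T)
        obtain ⟨N1, h1⟩ := ihm (A \ {a}) (by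
          have := Set.ncard_sdiff_singleton_lt_of_mem ha (Set.toFinite A)
          omega) (Set.sdiff_subset.trans hAT)
        obtain ⟨N2, h2⟩ := ihn ((a * ·) '' T) (by omega) (by
          rintro _ ⟨x, hx, rfl⟩ _ ⟨y, hy, rfl⟩
          exact ⟨x * (a * y), hmul _ hx _ (hmul _ haT _ hy), by simp [mul_assoc]⟩)
          _ ((a * ·) '' T) le_rfl subset_rfl
        -- A block costs `N1 + 1`, a pair of blocks one more, a chain of pairs `N2`. The last two
        -- rounds attach a leftover unpaired block and the initial run without `a`. Pairs are needed
        -- because a block may be the single value `a`, which need not lie in `a T`.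
        refine ⟨N1 + 2 + N2 + 2, fun c P hc hP h i j hch => ?_⟩
        have h1 := h1 c P hc hP h
        have h2 := h2 c P hc hP (h + (N1 + 2))
        set Qa : ℕ → ℕ → Prop := fun i j => P h i j ∧ c i j = a with hQa
        set Qb : ℕ → ℕ → Prop := fun i j => P h i j ∧ c i j ∈ A \ {a} with hQb
        have hch' : TransGen (fun i j => Qa i j ∨ Qb i j) i j := by
          refine TransGen.mono (fun x y hxy => ?_) _ _ hch
          by_cases hx : c x y = a
          · exact .inl ⟨hxy.1, hx⟩
          · exact .inr ⟨hxy.1, hxy.2, hx⟩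
        have hvb : ∀ {i j}, TransGen Qb i j → i < j ∧ c i j ∈ T := fun h' =>
          hval hc hP (Set.sdiff_subset.trans hAT) h'
        set Z : ℕ → ℕ → Prop := fun i j => Qa i j ∨ ∃ k, Qa i k ∧ TransGen Qb k j with hZ
        have hPZ : ∀ i j, Z i j → P (h + N1 + 1) i j := by
          rintro i j (hq | ⟨k, hq, hq'⟩)
          · exact hP.mono (by omega) hq.1
          · exact hP.binary _ _ _ _ (hP.mono (by omega) hq.1) (h1 _ _ hq')
        have hcZ : ∀ i j, Z i j → c i j ∈ T ∧ (c i j = a ∨ c i j ∈ (a * ·) '' T) := by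
          rintro i j (hq | ⟨k, hq, hq'⟩)
          · exact ⟨hq.2 ▸ haT, .inl hq.2⟩
          · have : c i j ∈ (a * ·) '' T :=
              ⟨c k j, (hvb hq').2, by
                rw [hc i k j (hP.lt _ _ _ hq.1) (hvb hq').1, hq.2]⟩
            exact ⟨hsub this, .inr this⟩
        have hZZ : ∀ i j, TransGen (fun i j => ∃ m, Z i m ∧ Z m j) i j →
            P (h + (N1 + 2) + N2) i j := by
          intro i j hij
          refine h2 _ _ (TransGen.mono (fun x y hxy => ?_) _ _ hij)
          obtain ⟨m, hxm, hmy⟩ := hxy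
          refine ⟨hP.mono (by omega) (hP.binary _ _ _ _ (hPZ _ _ hxm) (hPZ _ _ hmy)), ?_⟩
          rw [hc x m y (hP.lt _ _ _ (hPZ _ _ hxm)) (hP.lt _ _ _ (hPZ _ _ hmy))]
          rcases (hcZ _ _ hxm).2 with h3 | ⟨t, ht, h3⟩
          · exact ⟨c m y, (hcZ _ _ hmy).1, by simp [h3]⟩
          · refine ⟨t * c m y, hmul _ ht _ (hcZ _ _ hmy).1, ?_⟩
            rw [← h3]; simp [mul_assoc]
        have hZ' : ∀ i j, TransGen Z i j → P (h + (N1 + 2) + N2 + 1) i j := by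
          intro i j hij
          obtain ⟨k, hk, hk'⟩ := transGen_pair_steps hij
          rcases hk with rfl | hk <;> rcases hk' with rfl | hk'
          · have hlt' : ∀ b, TransGen Z i b → i < b := by
              intro b hb
              induction hb with
              | single hs => exact hP.lt _ _ _ (hPZ _ _ hs)
              | tail _ hs ih => exact ih.trans (hP.lt _ _ _ (hPZ _ _ hs))
            exact absurd (hlt' i hij) (lt_irrefl _)
          · exact hP.mono (by omega) (hPZ _ _ hk')
          · exact hP.mono (by omega) (hZZ _ _ hk)
          · exact hP.binary _ _ _ _ (hZZ _ _ hk) (hP.mono (by omega) (hPZ _ _ hk'))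
        rcases transGen_split_or hch' with h3 | ⟨k, rfl | h3, h4⟩
        · exact hP.mono (by omega) (h1 _ _ h3)
        · exact hP.mono (by omega) (hZ' _ _ h4)
        · exact hP.mono (by omega) (hP.binary _ _ _ _ (hP.mono (by omega) (h1 _ _ h3)) (hZ' _ _ h4))

/-- Factorization forests of bounded height exist over a finite semigroup. -/
theorem FactorizationClosed.bounded (S : Type*) [Semigroup S] [Finite S] :
    ∃ N : ℕ, ∀ (c : ℕ → ℕ → S) (P : ℕ → ℕ → ℕ → Prop), Additive c → FactorizationClosed c P →
      (∀ i, P 0 i (i + 1)) → ∀ i j, i < j → P N i j := by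
  obtain ⟨N, hN⟩ := FactorizationClosed.bounded_aux _ (Set.univ : Set S) le_rfl (by simp) _
    Set.univ le_rfl subset_rfl
  refine ⟨N, fun c P hc hP h0 i j hij => ?_⟩
  have := hN c P hc hP 0 i j ?_
  · simpa using this
  · induction hij with
    | refl => exact .single ⟨h0 i, trivial⟩
    | step _ ih => exact ih.tail ⟨h0 _, trivial⟩

-- Guided elimination schemes and their gluing

universe u

variable {V : Type u} {G : SimpleGraph V}

/-- `v` and `w` are joined by a walk of `G` inside `U` (or are equal). -/
def ConnIn (G : SimpleGraph V) (U : Set V) : V → V → Prop :=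
  ReflTransGen fun a b => G.Adj a b ∧ a ∈ U ∧ b ∈ U

namespace ConnIn

theorem symm {U : Set V} {v w : V} (h : ConnIn G U v w) : ConnIn G U w v := by
  induction h with
  | refl => exact .refl
  | tail _ h ih => exact .head ⟨h.1.symm, h.2.2, h.2.1⟩ ih

theorem trans {U : Set V} {v w x : V} (h : ConnIn G U v w) (h' : ConnIn G U w x) :
    ConnIn G U v x :=
  ReflTransGen.trans h h'

theorem mono {U W : Set V} (hUW : U ⊆ W) {v w : V} (h : ConnIn G U v w) : ConnIn G W v w :=
  ReflTransGen.mono (fun _ _ h => ⟨h.1, hUW h.2.1, hUW h.2.2⟩) _ _ h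

theorem mem {U : Set V} {v w : V} (h : ConnIn G U v w) (hv : v ∈ U) : w ∈ U := by
  induction h with
  | refl => exact hv
  | tail _ h _ => exact h.2.2

theorem of_adj {U : Set V} {v w : V} (h : G.Adj v w) (hv : v ∈ U) (hw : w ∈ U) :
    ConnIn G U v w :=
  ReflTransGen.single ⟨h, hv, hw⟩

/-- A walk in `U` from `v` stays in the set of vertices joined to `v`. -/
theorem component {U : Set V} {v w : V} (h : ConnIn G U v w) (hv : v ∈ U) :
    ConnIn G {x | x ∈ U ∧ ConnIn G U x w} v w := by
  induction h using ReflTransGen.head_induction_on with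
  | refl => exact .refl
  | head h h' ih => exact .head ⟨h.1, ⟨h.2.1, .head h h'⟩, h.2.2, h'⟩ (ih h.2.2)

end ConnIn

/-- An elimination scheme for `G[U]` (equivalently, a tree decomposition whose bags are the sets
`{v} ∪ {x | up v x}`), together with guiding trees colored by `K`: `guide c v r` means that `v`
lies in a tree of color `c` with root `r`, the vertex sets of these trees being connected. -/
structure GuidedElim (G : SimpleGraph V) (K : Type) (U : Set V) where
  rank : V → ℕ
  up : V → V → Prop
  guide : K → V → V → Prop
  up_mem : ∀ v x, up v x → v ∈ U ∧ x ∈ U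
  up_rank : ∀ v x, up v x → rank v < rank x
  up_clique : ∀ v x y, up v x → up v y → x = y ∨ up x y ∨ up y x
  up_adj : ∀ v w, v ∈ U → w ∈ U → G.Adj v w → up v w ∨ up w v
  guide_mem : ∀ c v r, guide c v r → v ∈ U
  guide_unique : ∀ c v r r', guide c v r → guide c v r' → r = r'
  guide_conn : ∀ c v r, guide c v r → ConnIn G {w | guide c w r} v r
  captured : ∀ v, v ∈ U → ∃ w, (∃ c, guide c w v) ∧ ∀ x, up v x → ∃ c, guide c w x

namespace GuidedElim

theorem guide_connIn {K : Type} {U : Set V} (E : GuidedElim G K U) {c : K} {v r : V}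
    (h : E.guide c v r) : ConnIn G U v r :=
  (E.guide_conn c v r h).mono fun _ hw => E.guide_mem _ _ _ hw

/-- Both vertices lie in guiding trees through one capturing vertex, and these trees are connected
inside `U`. Hence a bag never leaves a component of `G[U]`. -/
theorem up_connIn {K : Type} {U : Set V} (E : GuidedElim G K U) {v x : V} (h : E.up v x) :
    ConnIn G U v x := by
  obtain ⟨w, ⟨c, hc⟩, hw⟩ := E.captured v (E.up_mem _ _ h).1
  obtain ⟨c', hc'⟩ := hw x h
  exact (E.guide_connIn hc).symm.trans (E.guide_connIn hc')

/-- Enlarging the set of colors. -/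
theorem map_colors {K K' : Type} {U : Set V} (E : GuidedElim G K U) (f : K ↪ K') :
    Nonempty (GuidedElim G K' U) :=
  ⟨{ rank := E.rank
     up := E.up
     guide := fun c v r => ∃ k, f k = c ∧ E.guide k v r
     up_mem := E.up_mem
     up_rank := E.up_rank
     up_clique := E.up_clique
     up_adj := E.up_adj
     guide_mem := by
       rintro c v r ⟨k, -, h⟩
       exact E.guide_mem _ _ _ h
     guide_unique := by
       rintro c v r r' ⟨k, rfl, h⟩ ⟨k', hk, h'⟩
       obtain rfl := f.injective hk
       exact E.guide_unique _ _ _ _ h h'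
     guide_conn := by
       rintro c v r ⟨k, rfl, h⟩
       refine ConnIn.mono ?_ (E.guide_conn _ _ _ h)
       exact fun w hw => ⟨k, rfl, hw⟩
     captured := by
       intro v hv
       obtain ⟨w, ⟨c, hc⟩, hw⟩ := E.captured v hv
       refine ⟨w, ⟨f c, c, rfl, hc⟩, fun x hx => ?_⟩
       obtain ⟨c', hc'⟩ := hw x hx
       exact ⟨f c', c', rfl, hc'⟩ }⟩

theorem of_isEmpty (G : SimpleGraph V) (K : Type) : Nonempty (GuidedElim G K ∅) :=
  ⟨{ rank := fun _ => 0
     up := fun _ _ => False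
     guide := fun _ _ _ => False
     up_mem := by simp
     up_rank := by simp
     up_clique := by simp
     up_adj := by simp
     guide_mem := by simp
     guide_unique := by simp
     guide_conn := by simp
     captured := by simp }⟩

/-- Gluing elimination schemes of disjoint pieces `D q` along a set `Y` of vertices that are
eliminated last; `Vis v x` says that `x ∈ Y` is added to the bag of `v`. -/
theorem glue [Finite V] {ι K K' : Type} {U Y : Set V} {D : ι → Set V}
    (E : ∀ q, GuidedElim G K (D q))
    (hdisj : ∀ q q' v, v ∈ D q → v ∈ D q' → q = q') (hDU : ∀ q v, v ∈ D q → v ∈ U)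
    (hYU : ∀ v ∈ Y, v ∈ U) (hcov : ∀ v ∈ U, v ∉ Y → ∃ q, v ∈ D q)
    (hadj : ∀ q q' v w, v ∈ D q → w ∈ D q' → v ∉ Y → w ∉ Y → G.Adj v w → q = q')
    (κ : V → ℕ) (Vis : V → V → Prop) (ρ : K' → V → V → Prop)
    (vis_mem : ∀ v x, Vis v x → v ∈ U ∧ x ∈ Y)
    (vis_rank : ∀ v x, v ∈ Y → Vis v x → κ v < κ x)
    (vis_conn : ∀ q v w x, v ∈ D q → w ∈ D q → v ∉ Y → w ∉ Y → ConnIn G (D q) v w →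
      Vis v x → Vis w x)
    (vis_clique : ∀ v x y, Vis v x → Vis v y → x = y ∨ Vis x y ∨ Vis y x)
    (vis_adj : ∀ v y, v ∈ U → y ∈ Y → G.Adj v y → Vis v y ∨ Vis y v)
    (g_mem : ∀ c v r, ρ c v r → v ∈ U)
    (g_unique : ∀ c v r r', ρ c v r → ρ c v r' → r = r')
    (g_conn : ∀ c v r, ρ c v r → ConnIn G {w | ρ c w r} v r)
    (g_piece : ∀ q v w x, v ∈ D q → w ∈ D q → v ∉ Y → ConnIn G (D q) v w →
      Vis v x → ∃ c, ρ c w x)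
    (g_cut : ∀ v ∈ Y, ∃ w, (∃ c, ρ c w v) ∧ ∀ x, Vis v x → ∃ c, ρ c w x) :
    Nonempty (GuidedElim G (K ⊕ K') U) := by
  classical
  obtain ⟨r, hr⟩ : ∃ r : V → ℕ, ∀ q v, v ∈ D q → r v = (E q).rank v := by
    refine ⟨fun v => if h : ∃ q, v ∈ D q then (E h.choose).rank v else 0, fun q v hv => ?_⟩
    have h : ∃ q, v ∈ D q := ⟨q, hv⟩
    simp only [h, dite_true]
    rw [hdisj _ _ _ h.choose_spec hv]
  -- `B` bounds all ranks in the pieces, so the offset `B + 1` places every vertex of `Y` above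
  -- them.
  obtain ⟨B, hB⟩ := (Set.finite_range r).bddAbove
  have hB : ∀ v, r v ≤ B := fun v => hB ⟨v, rfl⟩
  refine ⟨{
    rank := fun v => if v ∈ Y then B + 1 + κ v else r v
    up := fun v x => (v ∉ Y ∧ x ∉ Y ∧ ∃ q, (E q).up v x) ∨ Vis v x
    guide := fun c v x => Sum.elim (fun k => ∃ q, (E q).guide k v x) (fun k => ρ k v x) c
    up_mem := ?_
    up_rank := ?_
    up_clique := ?_
    up_adj := ?_
    guide_mem := ?_
    guide_unique := ?_
    guide_conn := ?_
    captured := ?_ }⟩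
  · rintro v x (⟨-, -, q, h⟩ | h)
    · exact ⟨hDU q _ ((E q).up_mem _ _ h).1, hDU q _ ((E q).up_mem _ _ h).2⟩
    · exact ⟨(vis_mem _ _ h).1, hYU _ (vis_mem _ _ h).2⟩
  · rintro v x (⟨hv, hx, q, h⟩ | h)
    · simp only [hv, hx, if_false]
      rw [hr q _ ((E q).up_mem _ _ h).1, hr q _ ((E q).up_mem _ _ h).2]
      exact (E q).up_rank _ _ h
    · simp only [(vis_mem _ _ h).2, if_true]
      by_cases hv : v ∈ Y
      · simp only [hv, if_true]
        have := vis_rank _ _ hv h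
        omega
      · simp only [hv, if_false]
        have := hB v
        omega
  · have key : ∀ v x y, (v ∉ Y ∧ x ∉ Y ∧ ∃ q, (E q).up v x) → Vis v y → Vis x y := by
      rintro v x y ⟨hv, hx, q, h⟩ h'
      exact vis_conn q v x y ((E q).up_mem _ _ h).1 ((E q).up_mem _ _ h).2 hv hx
        ((E q).up_connIn h) h'
    rintro v x y (h | h) (h' | h')
    · obtain ⟨hv, hx, q, h⟩ := h
      obtain ⟨-, hy, q', h'⟩ := h'
      obtain rfl := hdisj _ _ _ ((E q).up_mem _ _ h).1 ((E q').up_mem _ _ h').1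
      rcases (E q).up_clique _ _ _ h h' with h1 | h1 | h1
      · exact .inl h1
      · exact .inr (.inl (.inl ⟨hx, hy, q, h1⟩))
      · exact .inr (.inr (.inl ⟨hy, hx, q, h1⟩))
    · exact .inr (.inl (.inr (key _ _ _ h h')))
    · exact .inr (.inr (.inr (key _ _ _ h' h)))
    · rcases vis_clique _ _ _ h h' with h1 | h1 | h1
      · exact .inl h1
      · exact .inr (.inl (.inr h1))
      · exact .inr (.inr (.inr h1))
  · intro v w hv hw hvw
    by_cases hvY : v ∈ Y
    · exact (vis_adj w v hw hvY hvw.symm).symm.imp .inr .inr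
    by_cases hwY : w ∈ Y
    · exact (vis_adj v w hv hwY hvw).imp .inr .inr
    obtain ⟨q, hq⟩ := hcov v hv hvY
    obtain ⟨q', hq'⟩ := hcov w hw hwY
    obtain rfl := hadj _ _ _ _ hq hq' hvY hwY hvw
    exact ((E q).up_adj _ _ hq hq' hvw).imp (fun h => .inl ⟨hvY, hwY, q, h⟩)
      (fun h => .inl ⟨hwY, hvY, q, h⟩)
  · rintro (c | c) v x h
    · obtain ⟨q, h⟩ := h
      exact hDU q _ ((E q).guide_mem _ _ _ h)
    · exact g_mem _ _ _ h
  · rintro (c | c) v x x' h h'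
    · obtain ⟨q, h⟩ := h
      obtain ⟨q', h'⟩ := h'
      obtain rfl := hdisj _ _ _ ((E q).guide_mem _ _ _ h) ((E q').guide_mem _ _ _ h')
      exact (E q).guide_unique _ _ _ _ h h'
    · exact g_unique _ _ _ _ h h'
  · rintro (c | c) v x h
    · obtain ⟨q, h⟩ := h
      refine ConnIn.mono ?_ ((E q).guide_conn _ _ _ h)
      exact fun w hw => ⟨q, hw⟩
    · exact g_conn _ _ _ h
  · intro v hv
    by_cases hvY : v ∈ Y
    · obtain ⟨w, ⟨c, hc⟩, hw⟩ := g_cut v hvY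
      refine ⟨w, ⟨.inr c, hc⟩, ?_⟩
      rintro x (⟨h, -⟩ | h)
      · exact absurd hvY h
      · obtain ⟨c', hc'⟩ := hw x h
        exact ⟨.inr c', hc'⟩
    · obtain ⟨q, hq⟩ := hcov v hv hvY
      obtain ⟨w, ⟨c, hc⟩, hw⟩ := (E q).captured v hq
      refine ⟨w, ⟨.inl c, q, hc⟩, ?_⟩
      rintro x (⟨-, -, q', h⟩ | h)
      · obtain rfl := hdisj _ _ _ hq ((E q').up_mem _ _ h).1
        obtain ⟨c', hc'⟩ := hw x h
        exact ⟨.inl c', q, hc'⟩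
      -- The vertex capturing the old bag lies in the component of `v` in the piece, so the new
      -- trees reach it as well.
      · obtain ⟨c', hc'⟩ := g_piece q v w x hq ((E q).guide_mem _ _ _ hc) hvY
          ((E q).guide_connIn hc).symm h
        exact ⟨.inr c', hc'⟩

/-- Adding a set `Y` of boundedly many vertices. -/
theorem add_bounded [Finite V] {ι K : Type} {l : ℕ} {U Y : Set V} {D : ι → Set V}
    (E : ∀ q, GuidedElim G K (D q))
    (hdisj : ∀ q q' v, v ∈ D q → v ∈ D q' → q = q') (hDU : ∀ q v, v ∈ D q → v ∈ U)
    (hYU : ∀ v ∈ Y, v ∈ U) (hcov : ∀ v ∈ U, v ∉ Y → ∃ q, v ∈ D q)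
    (hadj : ∀ q q' v w, v ∈ D q → w ∈ D q' → v ∉ Y → w ∉ Y → G.Adj v w → q = q')
    (hY : Y.ncard ≤ l) :
    Nonempty (GuidedElim G (K ⊕ Fin l) U) := by
  classical
  obtain ⟨idx, hidx⟩ : ∃ idx : V → ℕ, (∀ v ∈ Y, idx v < l) ∧
      ∀ v ∈ Y, ∀ w ∈ Y, idx v = idx w → v = w := by
    have := Fintype.ofFinite Y
    have hc : Fintype.card Y ≤ l := by rwa [← Nat.card_eq_fintype_card, Nat.card_coe_set_eq]
    refine ⟨fun v => if h : v ∈ Y then (Fintype.equivFin Y ⟨v, h⟩ : ℕ) else 0, ?_, ?_⟩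
    · intro v hv
      simp only [hv, dite_true]
      exact (Fin.isLt _).trans_le hc
    · intro v hv w hw h
      simp only [hv, hw, dite_true] at h
      simpa using (Fintype.equivFin Y).injective (Fin.ext h)
  have tri : ∀ v x y, ConnIn G U v x → ConnIn G U v y → x ∈ Y → y ∈ Y → x = y ∨
      (x ∈ U ∧ y ∈ Y ∧ ConnIn G U x y ∧ (x ∈ Y → idx x < idx y)) ∨
      (y ∈ U ∧ x ∈ Y ∧ ConnIn G U y x ∧ (y ∈ Y → idx y < idx x)) := by
    intro v x y hx hy hxY hyY
    rcases lt_trichotomy (idx x) (idx y) with h | h | h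
    · exact .inr (.inl ⟨hYU _ hxY, hyY, hx.symm.trans hy, fun _ => h⟩)
    · exact .inl (hidx.2 _ hxY _ hyY h)
    · exact .inr (.inr ⟨hYU _ hyY, hxY, hy.symm.trans hx, fun _ => h⟩)
  -- A vertex of `Y` is visible throughout its component of `G[U]`, up to the order `idx` on `Y`.
  -- That component is its guiding tree, with its index as color.
  refine glue E hdisj hDU hYU hcov hadj idx
    (fun v x => v ∈ U ∧ x ∈ Y ∧ ConnIn G U v x ∧ (v ∈ Y → idx v < idx x))
    (fun c v x => v ∈ U ∧ x ∈ Y ∧ ConnIn G U v x ∧ idx x = c) ?_ ?_ ?_ ?_ ?_ ?_ ?_ ?_ ?_ ?_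
  · rintro v x ⟨h1, h2, -⟩
    exact ⟨h1, h2⟩
  · rintro v x hv ⟨-, -, -, h⟩
    exact h hv
  · rintro q v w x hv hw hvY hwY hvw ⟨h1, h2, h3, h4⟩
    exact ⟨hDU q w hw, h2, (hvw.mono (hDU q)).symm.trans h3, fun h => absurd h hwY⟩
  · rintro v x y ⟨-, hx, hvx, -⟩ ⟨-, hy, hvy, -⟩
    exact tri v x y hvx hvy hx hy
  · intro v y hv hy hvy
    have hc : ConnIn G U v y := .of_adj hvy hv (hYU _ hy)
    by_cases hvY : v ∈ Y
    · rcases tri v v y .refl hc hvY hy with h | h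
      · exact absurd h hvy.ne
      · exact h
    · exact .inl ⟨hv, hy, hc, fun h => absurd h hvY⟩
  · rintro c v r ⟨h, -⟩
    exact h
  · rintro c v r r' ⟨-, hr, -, h⟩ ⟨-, hr', -, h'⟩
    exact hidx.2 _ hr _ hr' (h.trans h'.symm)
  · rintro c v r ⟨hv, hr, hc, h⟩
    refine ConnIn.mono ?_ (hc.component hv)
    exact fun w hw => ⟨hw.1, hr, hw.2, h⟩
  · rintro q v w x hv hw - hvw ⟨-, h2, h3, -⟩
    exact ⟨⟨idx x, hidx.1 x h2⟩, hDU q w hw, h2, (hvw.mono (hDU q)).symm.trans h3, rfl⟩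
  · intro v hv
    refine ⟨v, ⟨⟨idx v, hidx.1 v hv⟩, hYU v hv, hv, .refl, rfl⟩, ?_⟩
    rintro x ⟨h1, h2, h3, -⟩
    exact ⟨⟨idx x, hidx.1 x h2⟩, h1, h2, h3, rfl⟩

/-- Gluing along a linear sequence of cuts. Vertices in even position `2 * s` form the `s`-th cut,
those in odd position `2 * s + 1` the piece between the cuts `s` and `s + 1`; connectivity around
a cut is witnessed within bounded distance. -/
theorem glue_linear [Finite V] {K : Type} {l : ℕ} {U : Set V} (pos : V → ℕ) (idx : V → Fin l)
    (E : ∀ q : ℕ, GuidedElim G K {v | v ∈ U ∧ pos v = 2 * q + 1})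
    (hidx : ∀ v ∈ U, ∀ w ∈ U, Even (pos v) → pos v = pos w → idx v = idx w → v = w)
    (hadj : ∀ v ∈ U, ∀ w ∈ U, G.Adj v w → pos v ≤ pos w →
      pos w ≤ pos v + 1 ∨ (Even (pos v) ∧ pos w = pos v + 2))
    (hloc : ∀ v ∈ U, ∀ x ∈ U, Even (pos x) →
      ((pos v ≤ pos x + 1 ∧ pos x ≤ pos v + 1) ∨ (Even (pos v) ∧ pos x = pos v + 2)) →
      ConnIn G U v x → ConnIn G {w | w ∈ U ∧ pos w ≤ pos x + 4 ∧ pos x ≤ pos w + 4} v x) :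
    Nonempty (GuidedElim G (K ⊕ (Fin 5 × Fin l)) U) := by
  classical
  set Vis : V → V → Prop := fun v x => v ∈ U ∧ x ∈ U ∧ Even (pos x) ∧ ConnIn G U v x ∧
    ((Odd (pos v) ∧ (pos x = pos v + 1 ∨ pos v = pos x + 1)) ∨
      (Even (pos v) ∧ (pos x = pos v + 2 ∨ (pos x = pos v ∧ idx v < idx x)))) with hVis
  set W : V → Set V := fun x => {w | w ∈ U ∧ pos w ≤ pos x + 4 ∧ pos x ≤ pos w + 4} with hW
  have tri : ∀ x y, x ∈ U → y ∈ U → ConnIn G U x y → Even (pos x) → Even (pos y) →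
      pos x ≤ pos y + 2 → pos y ≤ pos x + 2 → x = y ∨ Vis x y ∨ Vis y x := by
    intro x y hx hy hc hex hey h1 h2
    obtain ⟨a, ha⟩ := hex
    obtain ⟨b, hb⟩ := hey
    rcases lt_trichotomy (pos x) (pos y) with h | h | h
    · exact .inr (.inl ⟨hx, hy, ⟨b, hb⟩, hc, .inr ⟨⟨a, ha⟩, .inl (by omega)⟩⟩)
    · rcases lt_trichotomy (idx x) (idx y) with h' | h' | h'
      · exact .inr (.inl ⟨hx, hy, ⟨b, hb⟩, hc, .inr ⟨⟨a, ha⟩, .inr ⟨h.symm, h'⟩⟩⟩)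
      · exact .inl (hidx x hx y hy ⟨a, ha⟩ h h')
      · exact .inr (.inr ⟨hy, hx, ⟨a, ha⟩, hc.symm, .inr ⟨⟨b, hb⟩, .inr ⟨h, h'⟩⟩⟩)
    · exact .inr (.inr ⟨hy, hx, ⟨a, ha⟩, hc.symm, .inr ⟨⟨b, hb⟩, .inl (by omega)⟩⟩)
  have near : ∀ v x, Vis v x → (pos v ≤ pos x + 1 ∧ pos x ≤ pos v + 1) ∨
      (Even (pos v) ∧ pos x = pos v + 2) := by
    rintro v x ⟨-, -, -, -, ⟨-, h⟩ | ⟨h, h' | h'⟩⟩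
    · left; omega
    · exact .inr ⟨h, h'⟩
    · left; omega
  have hmod : ∀ x : V, pos x / 2 % 5 < 5 := fun x => Nat.mod_lt _ (by norm_num)
  -- Cuts are eliminated from left to right, since `idx < l` makes `pos * l + idx` lexicographic.
  -- The guiding tree of `x` is its component in the window `W x`, and its color is its cut number
  -- modulo 5 with its label. Two windows sharing a vertex have centers at most 8 positions, thus 4
  -- cuts, apart, so residues modulo 5 tell the cuts apart.
  refine glue (Y := {v | v ∈ U ∧ Even (pos v)}) E ?_ ?_ ?_ ?_ ?_ (fun v => pos v * l + idx v) Vis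
    (fun c v x => x ∈ U ∧ Even (pos x) ∧ idx x = c.2 ∧ pos x / 2 % 5 = c.1 ∧ v ∈ W x ∧
      ConnIn G (W x) v x) ?_ ?_ ?_ ?_ ?_ ?_ ?_ ?_ ?_ ?_
  · rintro q q' v ⟨-, h⟩ ⟨-, h'⟩
    omega
  · exact fun q v h => h.1
  · exact fun v h => h.1
  · intro v hv hvY
    have : ¬ Even (pos v) := fun h => hvY ⟨hv, h⟩
    obtain ⟨q, hq⟩ := Nat.not_even_iff_odd.1 this
    exact ⟨q, hv, hq⟩
  · rintro q q' v w ⟨hv, hq⟩ ⟨hw, hq'⟩ hvY hwY hvw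
    rcases le_total (pos v) (pos w) with h | h
    · rcases hadj v hv w hw hvw h with h1 | h1
      · omega
      · exact absurd ⟨hv, h1.1⟩ hvY
    · rcases hadj w hw v hv hvw.symm h with h1 | h1
      · omega
      · exact absurd ⟨hw, h1.1⟩ hwY
  · exact fun v x h => ⟨h.1, h.2.1, h.2.2.1⟩
  · rintro v x ⟨-, hv⟩ ⟨-, -, -, -, ⟨h, -⟩ | ⟨-, h | ⟨h, h'⟩⟩⟩
    · exact absurd hv (Nat.not_even_iff_odd.2 h)
    · have := (idx v).isLt
      rw [h, add_mul]
      omega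
    · have : (idx v : ℕ) < idx x := h'
      rw [h]
      omega
  · rintro q v w x ⟨hv, hq⟩ ⟨hw, hq'⟩ - - hvw ⟨-, hx, hex, hvx, h⟩
    refine ⟨hw, hx, hex, (hvw.mono fun _ h => h.1).symm.trans hvx, ?_⟩
    rcases h with h | ⟨h, -⟩
    · rw [hq', ← hq]
      exact .inl h
    · exact absurd h (Nat.not_even_iff_odd.2 ⟨q, hq⟩)
  · rintro v x y ⟨hv, hx, hex, hvx, h⟩ ⟨-, hy, hey, hvy, h'⟩
    apply tri x y hx hy (hvx.symm.trans hvy) hex hey <;>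
      rcases h with ⟨⟨a, ha⟩, h⟩ | ⟨⟨a, ha⟩, h⟩ <;>
      rcases h' with ⟨⟨b, hb⟩, h'⟩ | ⟨⟨b, hb⟩, h'⟩ <;> omega
  · rintro v y hv ⟨hy, hey⟩ hvy
    have hc : ConnIn G U v y := .of_adj hvy hv hy
    have hle : (pos y ≤ pos v + 1 ∧ pos v ≤ pos y + 1) ∨ (Even (pos v) ∧
        (pos y = pos v + 2 ∨ pos v = pos y + 2)) := by
      rcases le_total (pos v) (pos y) with h | h
      · rcases hadj v hv y hy hvy h with h1 | h1
        · left; omega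
        · exact .inr ⟨h1.1, .inl h1.2⟩
      · rcases hadj y hy v hv hvy.symm h with h1 | h1
        · left; omega
        · refine .inr ⟨?_, .inr h1.2⟩
          rw [h1.2]
          exact hey.add (by decide)
    rcases Nat.even_or_odd (pos v) with he | ho
    · have := tri v y hv hy hc he hey (by omega) (by omega)
      exact this.resolve_left hvy.ne
    · have h1 := hle.resolve_right fun h => absurd h.1 (Nat.not_even_iff_odd.2 ho)
      refine .inl ⟨hv, hy, hey, hc, .inl ⟨ho, ?_⟩⟩
      obtain ⟨a, ha⟩ := ho
      obtain ⟨b, hb⟩ := hey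
      omega
  · rintro c v r ⟨-, -, -, -, h, -⟩
    exact h.1
  · rintro c v r r' ⟨hr, her, h1, h2, h3, -⟩ ⟨hr', her', h1', h2', h3', -⟩
    refine hidx r hr r' hr' her ?_ (h1.trans h1'.symm)
    obtain ⟨a, ha⟩ := her
    obtain ⟨b, hb⟩ := her'
    have h4 := h3.2
    have h4' := h3'.2
    omega
  · rintro c v r ⟨hr, her, h1, h2, h3, h4⟩
    refine ConnIn.mono ?_ (h4.component h3)
    exact fun w hw => ⟨hr, her, h1, h2, hw.1, hw.2⟩
  · rintro q v w x ⟨hv, hq⟩ ⟨hw, hq'⟩ - hvw hvis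
    have hn := near v x hvis
    obtain ⟨-, hx, hex, hvx, -⟩ := hvis
    have hwx : ConnIn G U w x := (hvw.mono fun _ h => h.1).symm.trans hvx
    rw [hq, ← hq'] at hn
    refine ⟨⟨⟨_, hmod x⟩, idx x⟩, hx, hex, rfl, rfl, ⟨hw, ?_⟩, hloc w hw x hx hex hn hwx⟩
    omega
  · rintro v ⟨hv, hev⟩
    refine ⟨v, ⟨⟨⟨_, hmod v⟩, idx v⟩, hv, hev, rfl, rfl, ⟨hv, by omega⟩, .refl⟩, ?_⟩
    intro x hvis
    have hn := near v x hvis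
    obtain ⟨-, hx, hex, hvx, -⟩ := hvis
    exact ⟨⟨⟨_, hmod x⟩, idx x⟩, hx, hex, rfl, rfl, ⟨hv, by omega⟩, hloc v hv x hx hex hn hvx⟩

end GuidedElim

/-! ### From elimination schemes to tree decompositions -/

theorem ConnIn.reachable_induce {U : Set V} {v w : V} (h : ConnIn G U v w) (hv : v ∈ U)
    (hw : w ∈ U) : (G.induce U).Reachable ⟨v, hv⟩ ⟨w, hw⟩ := by
  induction h with
  | refl => rfl
  | tail _ h ih =>
    refine (ih h.2.1).trans (SimpleGraph.Adj.reachable ?_)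
    exact h.1

/-- A finite connected vertex set carries an in-tree with prescribed root. -/
theorem exists_inTree [Finite V] (U : Set V) (r : V) (hr : r ∈ U)
    (h : ∀ v ∈ U, ConnIn G U v r) : ∃ t : InTree G, t.tree.verts = U ∧ t.root = r := by
  have hconn : (G.induce U).Connected := by
    rw [SimpleGraph.connected_iff]
    refine ⟨fun v w => ?_, ⟨⟨r, hr⟩⟩⟩
    exact ((h v v.2).reachable_induce v.2 hr).trans ((h w w.2).reachable_induce w.2 hr).symm
  obtain ⟨T, hT, htree⟩ := hconn.exists_isTree_le
  let S : G.Subgraph :=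
    { verts := U
      Adj := fun a b => ∃ ha hb, T.Adj ⟨a, ha⟩ ⟨b, hb⟩
      adj_sub := by
        rintro a b ⟨ha, hb, hab⟩
        exact hT hab
      edge_vert := by
        rintro a b ⟨ha, hb, hab⟩
        exact ha
      symm := ⟨by
        rintro a b ⟨ha, hb, hab⟩
        exact ⟨hb, ha, hab.symm⟩⟩ }
  have hS : S.coe = T := by
    ext a b
    change (∃ ha hb, T.Adj ⟨a, ha⟩ ⟨b, hb⟩) ↔ T.Adj a b
    exact ⟨fun ⟨_, _, h⟩ => h, fun h => ⟨a.2, b.2, h⟩⟩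
  exact ⟨⟨S, by rw [hS]; exact htree, r, hr⟩, rfl, rfl⟩

namespace GuidedElim

variable {K : Type} {U : Set V} (E : GuidedElim G K U)

/-- `w` is the vertex of smallest rank among those above `v`. -/
def Parent (v w : V) : Prop :=
  E.up v w ∧ ∀ x, E.up v x → E.rank w ≤ E.rank x

theorem Parent.eq_or_up {v w x : V} (h : E.Parent v w) (hx : E.up v x) : w = x ∨ E.up w x := by
  rcases E.up_clique _ _ _ h.1 hx with h1 | h1 | h1
  · exact .inl h1
  · exact .inr h1
  · have := E.up_rank _ _ h1
    have := h.2 x hx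
    omega

theorem Parent.unique {v w w' : V} (h : E.Parent v w) (h' : E.Parent v w') : w = w' := by
  rcases Parent.eq_or_up E h h'.1 with h1 | h1
  · exact h1
  · have := E.up_rank _ _ h1
    have := h'.2 w h.1
    omega

theorem exists_parent {v x : V} (h : E.up v x) : ∃ w, E.Parent v w := by
  obtain ⟨w, hw, hmin⟩ := (measure E.rank).wf.has_min {w | E.up v w} ⟨x, h⟩
  exact ⟨w, hw, fun y hy => not_lt.1 (hmin y hy)⟩

/-- The elimination forest. -/
def forest {ι : Type} (e : ι ≃ V) : SimpleGraph ι where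
  Adj i j := E.Parent (e i) (e j) ∨ E.Parent (e j) (e i)
  symm := ⟨fun _ _ h => h.symm⟩
  loopless := ⟨fun i h => by
    have : E.Parent (e i) (e i) := h.elim id id
    exact lt_irrefl _ (E.up_rank _ _ this.1)⟩

/-- Every edge is a bridge: without the edge from `i` to its parent `j`, only descendants of `i`
remain reachable from `i`, and these have rank at most that of `i`, below that of `j`. -/
theorem forest_isAcyclic {ι : Type} (e : ι ≃ V) : (E.forest e).IsAcyclic := by
  have key : ∀ i j, E.Parent (e i) (e j) →
      ¬ ((E.forest e) \ SimpleGraph.fromEdgeSet {s(i, j)}).Reachable i j := by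
    intro i j hij hreach
    have hdesc : ∀ k, ((E.forest e) \ SimpleGraph.fromEdgeSet {s(i, j)}).Reachable i k →
        ReflTransGen E.Parent (e k) (e i) := by
      intro k hk
      rw [SimpleGraph.reachable_iff_reflTransGen] at hk
      induction hk with
      | refl => exact .refl
      | @tail a b _ hab ih =>
        rw [SimpleGraph.sdiff_adj, SimpleGraph.fromEdgeSet_adj] at hab
        obtain ⟨hab | hab, hne⟩ := hab
        · rcases ReflTransGen.cases_head ih with h | ⟨c, hc, hc'⟩
          · obtain rfl := e.injective h
            have := Parent.unique E hij hab
            obtain rfl := e.injective this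
            exact absurd ⟨rfl, fun h => lt_irrefl _ (h ▸ E.up_rank _ _ hij.1)⟩ hne
          · obtain rfl := Parent.unique E hab hc
            exact hc'
        · exact .head hab ih
    have hle : ∀ v w, ReflTransGen E.Parent v w → E.rank v ≤ E.rank w := by
      intro v w h
      induction h with
      | refl => exact le_rfl
      | tail _ h ih => exact ih.trans (E.up_rank _ _ h.1).le
    exact absurd (hle _ _ (hdesc j hreach)) (not_le.2 (E.up_rank _ _ hij.1))
  rw [SimpleGraph.isAcyclic_iff_forall_adj_isBridge]
  intro i j hij
  rw [SimpleGraph.isBridge_iff]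
  rcases hij with h | h
  · exact key i j h
  · intro hreach
    rw [Sym2.eq_swap] at hreach
    exact key j i h hreach.symm

/-- A guided elimination scheme for `G` yields a tree decomposition with captured bags. -/
theorem exists_treeDecomposition [Finite V] {N : ℕ} (E : GuidedElim G (Fin N) Set.univ) :
    ∃ (T : TreeDecomposition G) (Λ : GuidanceSystem G),
      T.width ≤ N ∧ Λ.Colorable N ∧ ∀ x : T.Node, Λ.Captures (T.bag x) := by
  classical
  -- Nodes must live in `Type`, whereas `V` lies in an arbitrary universe.
  obtain ⟨n, ⟨e'⟩⟩ := Finite.exists_equiv_fin V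
  let e : Fin n ≃ V := e'.symm
  have := Fintype.ofFinite V
  let T : TreeDecomposition G :=
    { Node := Fin n
      forest := E.forest e
      isAcyclic := E.forest_isAcyclic e
      bag := fun i => {x | x = e i ∨ E.up (e i) x}
      connected := by
        intro v
        have hv : e.symm v ∈ {x | v ∈ ({x' | x' = e x ∨ E.up (e x) x'} : Finset V)} := by simp
        -- Climbing parents from any bag containing `v` stays among such bags and ends at the bag of
        -- `v`; the induction is on the remaining gap in rank.
        have key : ∀ m, ∀ i, ∀ hi : i ∈ {x | v ∈ ({x' | x' = e x ∨ E.up (e x) x'} : Finset V)},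
            E.rank v - E.rank (e i) ≤ m →
            ((E.forest e).induce _).Reachable ⟨i, hi⟩ ⟨e.symm v, hv⟩ := by
          intro m
          induction m with
          | zero =>
            intro i hi hm
            have hi' : v = e i ∨ E.up (e i) v := by simpa using hi
            rcases hi' with h | h
            · have : i = e.symm v := by simp [h]
              subst this
              rfl
            · have := E.up_rank _ _ h
              omega
          | succ m ih =>
            intro i hi hm
            have hi' : v = e i ∨ E.up (e i) v := by simpa using hi
            rcases hi' with h | h
            · have : i = e.symm v := by simp [h]
              subst this
              rfl
            · obtain ⟨w, hw⟩ := E.exists_parent h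
              have h1 := E.up_rank _ _ h
              have h2 := E.up_rank _ _ hw.1
              have hwv := Parent.eq_or_up E hw h
              have hmem : e.symm w ∈ {x | v ∈ ({x' | x' = e x ∨ E.up (e x) x'} : Finset V)} := by
                simpa [eq_comm] using hwv
              refine SimpleGraph.Reachable.trans (SimpleGraph.Adj.reachable ?_)
                (ih (e.symm w) hmem ?_)
              · change E.Parent _ _ ∨ E.Parent _ _
                left
                simpa using hw
              · simp only [Equiv.apply_symm_apply]
                omega
        rw [SimpleGraph.connected_iff]
        refine ⟨fun i j => ?_, ⟨⟨_, hv⟩⟩⟩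
        exact (key _ i.1 i.2 le_rfl).trans (key _ j.1 j.2 le_rfl).symm
      edge_mem := by
        intro v w hvw
        rcases E.up_adj v w trivial trivial hvw with h | h
        · exact ⟨e.symm v, by simp, by simp [h]⟩
        · exact ⟨e.symm w, by simp [h], by simp⟩ }
  have htree : ∀ c r, (∃ v, E.guide c v r) →
      ∃ t : InTree G, t.tree.verts = {v | E.guide c v r} ∧ t.root = r := by
    rintro c r ⟨v, hv⟩
    exact exists_inTree _ r ((E.guide_conn _ _ _ hv).mem hv) fun w hw => E.guide_conn _ _ _ hw
  choose t ht htr using htree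
  let Λ : GuidanceSystem G := {s | ∃ c r h, s = t c r h}
  have hcap : ∀ i : Fin n, ∃ w, ∀ x ∈ T.bag i, ∃ c, E.guide c w x := by
    intro i
    obtain ⟨w, hw, hw'⟩ := E.captured (e i) trivial
    refine ⟨w, fun x hx => ?_⟩
    have hx : x = e i ∨ E.up (e i) x := by simpa [T] using hx
    rcases hx with rfl | hx
    · exact hw
    · exact hw' x hx
  refine ⟨T, Λ, ?_, ?_, fun i => ?_⟩
  -- Choosing for each vertex of a bag the color of its tree through the capturing vertex is
  -- injective by `guide_unique`.
  · refine (Nat.sub_le _ _).trans (Finset.sup_le fun i _ => ?_)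
    obtain ⟨w, hw⟩ := hcap i
    obtain ⟨c₀, -⟩ := hw (e i) (by simp [T])
    have : Nonempty (Fin N) := ⟨c₀⟩
    choose! c hc using hw
    calc (T.bag i).card ≤ (Finset.univ : Finset (Fin N)).card := by
          refine Finset.card_le_card_of_injOn c (fun _ _ => Finset.mem_coe.2 (Finset.mem_univ _)) ?_
          intro x hx y hy hxy
          exact E.guide_unique _ _ _ _ (hc x hx) (hxy ▸ hc y hy)
      _ = N := by simp
  · choose c r hv ht' using fun s : Λ => s.2
    refine ⟨c, ?_⟩
    rintro s s' hne ⟨w, hw, hw'⟩ hcc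
    apply hne
    rw [ht' s, ht] at hw
    rw [ht' s', ht] at hw'
    have hw1 : E.guide (c s) w (r s) := hw
    have hw2 : E.guide (c s') w (r s') := hw'
    rw [← hcc] at hw2
    have := E.guide_unique _ _ _ _ hw1 hw2
    apply Subtype.ext
    rw [ht' s, ht' s']
    congr 1
  · obtain ⟨w, hw⟩ := hcap i
    refine ⟨w, fun x hx => ?_⟩
    obtain ⟨c, hc⟩ := hw x hx
    refine ⟨t c x ⟨w, hc⟩, ⟨c, x, ⟨w, hc⟩, rfl⟩, ?_, htr c x ⟨w, hc⟩⟩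
    rw [ht c x ⟨w, hc⟩]
    exact hc

end GuidedElim

/-! ### Connectivity types of intervals of bags -/

/-- In a union of two relations supported on `W₁` and `W₂`, excursions into `W₂` can be replaced
by jumps inside the separator `Q`. -/
theorem reflTransGen_restrict {α : Type*} {r₁ r₂ : α → α → Prop} {W₁ W₂ Q : Set α}
    (h₁ : ∀ a b, r₁ a b → a ∈ W₁ ∧ b ∈ W₁) (h₂ : ∀ a b, r₂ a b → a ∈ W₂ ∧ b ∈ W₂)
    (hQ : ∀ a, a ∈ W₁ → a ∈ W₂ → a ∈ Q) {x y : α} (hx : x ∈ W₁) (hy : y ∈ W₁)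
    (h : ReflTransGen (fun a b => r₁ a b ∨ r₂ a b) x y) :
    ReflTransGen (fun a b => r₁ a b ∨ (a ∈ Q ∧ b ∈ Q ∧ ReflTransGen r₂ a b)) x y := by
  set r := fun a b => r₁ a b ∨ (a ∈ Q ∧ b ∈ Q ∧ ReflTransGen r₂ a b) with hr
  have key : ∀ z, ReflTransGen (fun a b => r₁ a b ∨ r₂ a b) x z →
      (z ∈ W₁ ∧ ReflTransGen r x z) ∨
        (z ∉ W₁ ∧ ∃ s ∈ Q, ReflTransGen r x s ∧ ReflTransGen r₂ s z) := by
    intro z hz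
    induction hz with
    | refl => exact .inl ⟨hx, .refl⟩
    | @tail a b _ hab ih =>
      rcases hab with hab | hab
      · rcases ih with ⟨-, ih⟩ | ⟨ha, -⟩
        · exact .inl ⟨(h₁ _ _ hab).2, ih.tail (.inl hab)⟩
        · exact absurd (h₁ _ _ hab).1 ha
      · by_cases hb : b ∈ W₁
        · refine .inl ⟨hb, ?_⟩
          have hbQ := hQ b hb (h₂ _ _ hab).2
          rcases ih with ⟨ha, ih⟩ | ⟨ha, s, hs, ih, hsa⟩
          · exact ih.tail (.inr ⟨hQ a ha (h₂ _ _ hab).1, hbQ, .single hab⟩)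
          · exact ih.tail (.inr ⟨hs, hbQ, hsa.tail hab⟩)
        · refine .inr ⟨hb, ?_⟩
          rcases ih with ⟨ha, ih⟩ | ⟨ha, s, hs, ih, hsa⟩
          · exact ⟨a, hQ a ha (h₂ _ _ hab).1, ih, .single hab⟩
          · exact ⟨s, hs, ih, hsa.tail hab⟩
  rcases key y h with h | h
  · exact h.2
  · exact absurd hy h.1

/-- The relation on labels of `P` induced by reachability along `St`, with additional jumps
between vertices of `Q` prescribed by the relation `σ` on labels. -/
def transfer {L : Type*} (lab : V → L) (St : V → V → Prop) (P Q : Set V) (σ : L → L → Prop) :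
    L → L → Prop := fun a b =>
  ∃ v ∈ P, ∃ w ∈ P, lab v = a ∧ lab w = b ∧
    ReflTransGen (fun x y => St x y ∨ (x ∈ Q ∧ y ∈ Q ∧ σ (lab x) (lab y))) v w

/-- Without jumps, the transferred relation records exactly the reachability between vertices of
`P`; this is how connectivity is read off a type. -/
theorem transfer_bot_apply {L : Type*} {lab : V → L} {St : V → V → Prop} {P Q : Set V}
    (hinj : Set.InjOn lab P) {v w : V} (hv : v ∈ P) (hw : w ∈ P) :
    transfer lab St P Q (fun _ _ => False) (lab v) (lab w) ↔ ReflTransGen St v w := by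
  constructor
  · rintro ⟨v', hv', w', hw', h1, h2, h⟩
    obtain rfl := hinj hv' hv h1
    obtain rfl := hinj hw' hw h2
    simpa using h
  · intro h
    exact ⟨v, hv, w, hw, rfl, rfl, by simpa using h⟩

/-- Every excursion into the second side enters and leaves through the separator `Q`, where labels
determine vertices. It can therefore be summarized by a relation on labels. -/
theorem transfer_comp {L : Type*} {lab : V → L} {St St₁ St₂ : V → V → Prop}
    {P Q Z W₁ W₂ : Set V} (hSt : ∀ x y, St x y ↔ St₁ x y ∨ St₂ x y)
    (h₁ : ∀ a b, St₁ a b → a ∈ W₁ ∧ b ∈ W₁) (h₂ : ∀ a b, St₂ a b → a ∈ W₂ ∧ b ∈ W₂)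
    (hP : P ⊆ W₁) (hZ : Z ⊆ W₂) (hQ : ∀ a, a ∈ W₁ → a ∈ W₂ → a ∈ Q) (hinj : Set.InjOn lab Q)
    (σ : L → L → Prop) :
    transfer lab St P Z σ = transfer lab St₁ P Q (transfer lab St₂ Q Z σ) := by
  have hpull : ∀ x y, (x ∈ Q ∧ y ∈ Q ∧ transfer lab St₂ Q Z σ (lab x) (lab y)) ↔
      (x ∈ Q ∧ y ∈ Q ∧
        ReflTransGen (fun x y => St₂ x y ∨ (x ∈ Z ∧ y ∈ Z ∧ σ (lab x) (lab y))) x y) := by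
    intro x y
    refine and_congr_right fun hx => and_congr_right fun hy => ⟨?_, fun h => ?_⟩
    · rintro ⟨v', hv', w', hw', h1, h2, h⟩
      obtain rfl := hinj hv' hx h1
      obtain rfl := hinj hw' hy h2
      exact h
    · exact ⟨x, hx, y, hy, rfl, rfl, h⟩
  funext a b
  unfold transfer at hpull ⊢
  simp only [hpull, hSt]
  refine propext ⟨?_, ?_⟩
  · rintro ⟨v, hv, w, hw, rfl, rfl, h⟩
    refine ⟨v, hv, w, hw, rfl, rfl, reflTransGen_restrict h₁ (W₂ := W₂) ?_ hQ (hP hv) (hP hw) ?_⟩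
    · rintro a b (h | h)
      · exact h₂ _ _ h
      · exact ⟨hZ h.1, hZ h.2.1⟩
    · simpa only [or_assoc] using h
  · rintro ⟨v, hv, w, hw, rfl, rfl, h⟩
    refine ⟨v, hv, w, hw, rfl, rfl, ?_⟩
    clear hv hw
    induction h with
    | refl => exact .refl
    | tail _ h ih =>
      rcases h with h | ⟨-, -, h⟩
      · exact ih.tail (.inl (.inl h))
      · refine ih.trans (ReflTransGen.mono ?_ _ _ h)
        rintro x y (h | h)
        · exact .inl (.inr h)
        · exact .inr h

/-- A path decomposition indexed by `ℕ`, with a labelling of the vertices that is injective on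
every bag. -/
structure LabeledBags (G : SimpleGraph V) (l : ℕ) where
  bag : ℕ → Set V
  vertex_mem : ∀ v, ∃ t, v ∈ bag t
  edge_mem : ∀ v w, G.Adj v w → ∃ t, v ∈ bag t ∧ w ∈ bag t
  interval : ∀ {i j k : ℕ} {v : V}, i ≤ j → j ≤ k → v ∈ bag i → v ∈ bag k → v ∈ bag j
  lab : V → Fin l
  lab_inj : ∀ t, Set.InjOn lab (bag t)

namespace LabeledBags

variable {l : ℕ} (B : LabeledBags G l)

/-- The vertices occurring between positions `i` and `j`. -/
def span (i j : ℕ) : Set V := {v | ∃ t, i ≤ t ∧ t ≤ j ∧ v ∈ B.bag t}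

/-- The vertices occurring only strictly between positions `i` and `j`. -/
def inner (i j : ℕ) : Set V := {v | ∀ t, v ∈ B.bag t → i < t ∧ t < j}

/-- Adjacency inside the bags between `i` and `j`, avoiding the labels in `A`. -/
def step (A : Set (Fin l)) (i j : ℕ) (v w : V) : Prop :=
  G.Adj v w ∧ B.lab v ∉ A ∧ B.lab w ∉ A ∧ ∃ t, i ≤ t ∧ t ≤ j ∧ v ∈ B.bag t ∧ w ∈ B.bag t

/-- The labels of vertices occurring both at `i` and at `j`. -/
def persistent (i j : ℕ) : Set (Fin l) := {a | ∃ v, v ∈ B.bag i ∧ v ∈ B.bag j ∧ B.lab v = a}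

theorem mem_bag_of_mem_span {i j k : ℕ} {v : V} (h : v ∈ B.span i j) (h' : v ∈ B.span j k) :
    v ∈ B.bag j := by
  obtain ⟨t, -, ht, hv⟩ := h
  obtain ⟨t', ht', -, hv'⟩ := h'
  exact B.interval ht ht' hv hv'

theorem bag_subset_span {i j t : ℕ} (h : i ≤ t) (h' : t ≤ j) : B.bag t ⊆ B.span i j :=
  fun _ hv => ⟨t, h, h', hv⟩

theorem step_span {A : Set (Fin l)} {i j : ℕ} (v w : V) (h : B.step A i j v w) :
    v ∈ B.span i j ∧ w ∈ B.span i j := by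
  obtain ⟨-, -, -, t, h1, h2, h3, h4⟩ := h
  exact ⟨⟨t, h1, h2, h3⟩, ⟨t, h1, h2, h4⟩⟩

theorem step_mono {A : Set (Fin l)} {i j i' j' : ℕ} (hi : i' ≤ i) (hj : j ≤ j') (v w : V)
    (h : B.step A i j v w) : B.step A i' j' v w := by
  obtain ⟨h0, hv, hw, t, h1, h2, h3⟩ := h
  exact ⟨h0, hv, hw, t, hi.trans h1, h2.trans hj, h3⟩

theorem step_iff {A : Set (Fin l)} {i j k : ℕ} (hij : i ≤ j) (hjk : j ≤ k) (v w : V) :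
    B.step A i k v w ↔ B.step A i j v w ∨ B.step A j k v w := by
  constructor
  · rintro ⟨h0, hv, hw, t, h1, h2, h3⟩
    rcases le_total t j with h | h
    · exact .inl ⟨h0, hv, hw, t, h1, h, h3⟩
    · exact .inr ⟨h0, hv, hw, t, h, h2, h3⟩
  · rintro (h | h)
    · exact B.step_mono le_rfl hjk _ _ h
    · exact B.step_mono hij le_rfl _ _ h

theorem persistent_inter {i j k : ℕ} (hij : i ≤ j) (hjk : j ≤ k) :
    B.persistent i k = B.persistent i j ∩ B.persistent j k := by
  ext a
  constructor
  · rintro ⟨v, hi, hk, rfl⟩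
    have hj := B.interval hij hjk hi hk
    exact ⟨⟨v, hi, hj, rfl⟩, v, hj, hk, rfl⟩
  · rintro ⟨⟨v, hi, hj, rfl⟩, w, hj', hk, hw⟩
    obtain rfl := B.lab_inj j hj' hj hw
    exact ⟨w, hi, hk, rfl⟩

end LabeledBags

/-- The finite semigroup of connectivity types of intervals. -/
abbrev ConnType (l : ℕ) : Type :=
  (Set (Fin l) → Function.End (Fin l → Fin l → Prop)) ×
    (Set (Fin l) → (Function.End (Fin l → Fin l → Prop))ᵐᵒᵖ) × Function.End (Set (Fin l))

instance (l : ℕ) : Finite (ConnType l) := by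
  have h1 : Finite (Function.End (Fin l → Fin l → Prop)) :=
    inferInstanceAs (Finite ((Fin l → Fin l → Prop) → (Fin l → Fin l → Prop)))
  have h2 : Finite (Function.End (Set (Fin l))) :=
    inferInstanceAs (Finite (Set (Fin l) → Set (Fin l)))
  have h3 : Finite (Function.End (Fin l → Fin l → Prop))ᵐᵒᵖ :=
    Finite.of_equiv _ MulOpposite.opEquiv
  infer_instance

namespace LabeledBags

variable {l : ℕ} (B : LabeledBags G l)

/-- The connectivity type of the interval between `i` and `j`. -/
def connType (i j : ℕ) : ConnType l :=
  -- The components describe the left bag, the right bag and the persistent labels. Those for the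
  -- right bag compose in reverse order, hence the opposite monoid. All `A` are recorded, as the
  -- label set to be avoided varies with the chain.
  (fun A => transfer B.lab (B.step A i j) (B.bag i) (B.bag j),
    fun A => MulOpposite.op (transfer B.lab (B.step A i j) (B.bag j) (B.bag i)),
    fun X => X ∩ B.persistent i j)

theorem connType_additive : Additive B.connType := by
  intro i j k hij hjk
  have hij := hij.le
  have hjk := hjk.le
  refine Prod.ext ?_ (Prod.ext ?_ ?_)
  · funext A σ
    exact transfer_comp (B.step_iff hij hjk) B.step_span B.step_span
      (B.bag_subset_span le_rfl hij) (B.bag_subset_span hjk le_rfl)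
      (fun a h h' => B.mem_bag_of_mem_span h h') (B.lab_inj j) σ
  · funext A
    apply MulOpposite.unop_injective
    funext σ
    exact transfer_comp (fun x y => (B.step_iff hij hjk x y).trans or_comm) B.step_span B.step_span
      (B.bag_subset_span hjk le_rfl) (B.bag_subset_span le_rfl hij)
      (fun a h h' => B.mem_bag_of_mem_span h' h) (B.lab_inj j) σ
  · funext X
    change X ∩ B.persistent i k = X ∩ B.persistent j k ∩ B.persistent i j
    rw [B.persistent_inter hij hjk, Set.inter_assoc, Set.inter_comm (B.persistent j k)]

theorem persistent_eq_of_connType_eq {i j i' j' : ℕ} (h : B.connType i j = B.connType i' j') :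
    B.persistent i j = B.persistent i' j' := by
  have := congrFun (congrArg (fun c => c.2.2) h) Set.univ
  change Set.univ ∩ B.persistent i j = Set.univ ∩ B.persistent i' j' at this
  simpa using this

/-- Moving the left end without changing the type preserves connectivity between vertices of the
right bag. -/
theorem left_conn_of_connType_eq {i j i' : ℕ} (h : B.connType i j = B.connType i' j)
    {A : Set (Fin l)} {v w : V} (hv : v ∈ B.bag j) (hw : w ∈ B.bag j)
    (hvw : ReflTransGen (B.step A i j) v w) : ReflTransGen (B.step A i' j) v w := by
  have := congrFun (congrArg MulOpposite.unop (congrFun (congrArg (fun c => c.2.1) h) A))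
    (fun _ _ => False)
  change transfer B.lab (B.step A i j) (B.bag j) (B.bag i) (fun _ _ => False) =
    transfer B.lab (B.step A i' j) (B.bag j) (B.bag i') (fun _ _ => False) at this
  rw [← transfer_bot_apply (Q := B.bag i) (B.lab_inj j) hv hw, this,
    transfer_bot_apply (B.lab_inj j) hv hw] at hvw
  exact hvw

theorem right_conn_of_connType_eq {i j j' : ℕ} (h : B.connType i j = B.connType i j')
    {A : Set (Fin l)} {v w : V} (hv : v ∈ B.bag i) (hw : w ∈ B.bag i)
    (hvw : ReflTransGen (B.step A i j) v w) : ReflTransGen (B.step A i j') v w := by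
  have := congrFun (congrFun (congrArg (fun c => c.1) h) A) (fun _ _ => False)
  change transfer B.lab (B.step A i j) (B.bag i) (B.bag j) (fun _ _ => False) =
    transfer B.lab (B.step A i j') (B.bag i) (B.bag j') (fun _ _ => False) at this
  rw [← transfer_bot_apply (Q := B.bag j) (B.lab_inj i) hv hw, this,
    transfer_bot_apply (B.lab_inj i) hv hw] at hvw
  exact hvw

end LabeledBags

/-! ### Chains of intervals of one type -/

namespace LabeledBags

variable {l : ℕ} (B : LabeledBags G l)

/-- An increasing sequence of positions all of whose intervals have the same connectivity type. -/
structure Homogeneous (e : ConnType l) (m : ℕ) (p : ℕ → ℕ) : Prop where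
  lt : ∀ s t, s < t → t ≤ m + 1 → p s < p t
  type_eq : ∀ s t, s < t → t ≤ m + 1 → B.connType (p s) (p t) = e

namespace Homogeneous

variable {B} {e : ConnType l} {m : ℕ} {p : ℕ → ℕ}

theorem le (H : B.Homogeneous e m p) {s t : ℕ} (h : s ≤ t) (ht : t ≤ m + 1) : p s ≤ p t := by
  rcases h.eq_or_lt with rfl | h
  · exact le_rfl
  · exact (H.lt _ _ h ht).le

theorem persistent_eq (H : B.Homogeneous e m p) {s t s' t' : ℕ} (h : s < t) (ht : t ≤ m + 1)
    (h' : s' < t') (ht' : t' ≤ m + 1) : B.persistent (p s) (p t) = B.persistent (p s') (p t') :=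
  B.persistent_eq_of_connType_eq ((H.type_eq _ _ h ht).trans (H.type_eq _ _ h' ht').symm)

theorem lab_mem (H : B.Homogeneous e m p) {s t : ℕ} (h : s < t) (ht : t ≤ m + 1) {v : V}
    (hs : v ∈ B.bag (p s)) (hv : v ∈ B.bag (p t)) : B.lab v ∈ B.persistent (p 0) (p 1) := by
  rw [← H.persistent_eq h ht Nat.zero_lt_one (by omega)]
  exact ⟨v, hs, hv, rfl⟩

/-- The vertex witnessing persistence of the label lies in every bag of the chain, so injectivity of
labels on a bag identifies it with `v`. -/
theorem mem_bag (H : B.Homogeneous e m p) {v : V} (hv : v ∈ B.span (p 0) (p (m + 1)))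
    (hA : B.lab v ∈ B.persistent (p 0) (p 1)) {s : ℕ} (hs : s ≤ m + 1) : v ∈ B.bag (p s) := by
  rw [H.persistent_eq Nat.zero_lt_one (by omega) (Nat.succ_pos m) le_rfl] at hA
  obtain ⟨x, hx, hx', hxv⟩ := hA
  obtain ⟨t, h1, h2, ht⟩ := hv
  obtain rfl := B.lab_inj t (B.interval h1 h2 hx hx') ht hxv
  exact B.interval (H.le (Nat.zero_le _) hs) (H.le hs le_rfl) hx hx'

/-- Connectivity between the cuts `1` and `m` is witnessed within bounded distance. -/
theorem local_conn (H : B.Homogeneous e m p) {A : Set (Fin l)} {s t : ℕ} (hs : 1 ≤ s) (hst : s ≤ t)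
    (ht : t ≤ m) {v x : V} (hv : v ∈ B.span (p s) (p t)) (hx : x ∈ B.span (p s) (p t))
    (h : ReflTransGen (B.step A (p 1) (p m)) v x) :
    ReflTransGen (B.step A (p (max 1 (s - 1))) (p (min m (t + 1)))) v x := by
  have h1s : p 1 ≤ p s := H.le hs (by omega)
  have hst' : p s ≤ p t := H.le hst (by omega)
  have htm : p t ≤ p m := H.le ht (by omega)
  have hs0 : p (max 1 (s - 1)) ≤ p s := H.le (by omega) (by omega)
  have ht0 : p t ≤ p (min m (t + 1)) := H.le (by omega) (by omega)
  -- Edges are sorted into those between cuts `s` and `t`, right of `t`, and left of `s`. Left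
  -- excursions become jumps inside the bag at `p s`, right ones jumps inside the bag at `p t`.
  -- Since all types agree, each jump is then realized within one adjacent interval; the `max` and
  -- `min` treat the extreme cuts.
  have e1 : ReflTransGen (fun a b => (B.step A (p s) (p t) a b ∨ B.step A (p t) (p m) a b) ∨
      B.step A (p 1) (p s) a b) v x := by
    refine ReflTransGen.mono (fun a b hab => ?_) _ _ h
    rw [B.step_iff h1s (hst'.trans htm), B.step_iff hst' htm] at hab
    exact hab.symm
  have e2 := reflTransGen_restrict (W₁ := B.span (p s) (p m)) (W₂ := B.span (p 1) (p s))
    (Q := B.bag (p s)) (fun a b hab => B.step_span a b ((B.step_iff hst' htm a b).2 hab))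
    B.step_span (fun a ha ha' => B.mem_bag_of_mem_span ha' ha)
    (by
      obtain ⟨i, h1, h2, h3⟩ := hv
      exact ⟨i, h1, h2.trans htm, h3⟩)
    (by
      obtain ⟨i, h1, h2, h3⟩ := hx
      exact ⟨i, h1, h2.trans htm, h3⟩) e1
  have e3 : ReflTransGen (fun a b => (B.step A (p s) (p t) a b ∨
      (a ∈ B.bag (p s) ∧ b ∈ B.bag (p s) ∧ ReflTransGen (B.step A (p 1) (p s)) a b)) ∨
      B.step A (p t) (p m) a b) v x := by
    refine ReflTransGen.mono (fun a b hab => ?_) _ _ e2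
    tauto
  have e4 := reflTransGen_restrict (W₁ := B.span (p s) (p t)) (W₂ := B.span (p t) (p m))
    (Q := B.bag (p t)) (by
      rintro a b (hab | ⟨ha, hb, -⟩)
      · exact B.step_span a b hab
      · exact ⟨B.bag_subset_span le_rfl hst' ha, B.bag_subset_span le_rfl hst' hb⟩)
    B.step_span (fun a ha ha' => B.mem_bag_of_mem_span ha ha') hv hx e3
  clear e1 e2 e3 h hx
  induction e4 with
  | refl => exact .refl
  | @tail a b _ hab ih =>
    refine ih.trans ?_
    rcases hab with (hab | ⟨ha, hb, hab⟩) | ⟨ha, hb, hab⟩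
    · exact .single (B.step_mono hs0 ht0 _ _ hab)
    · have : ReflTransGen (B.step A (p (max 1 (s - 1))) (p s)) a b := by
        rcases hs.eq_or_lt with rfl | hs1
        · simpa using hab
        · have hmax : max 1 (s - 1) = s - 1 := by omega
          rw [hmax]
          exact B.left_conn_of_connType_eq ((H.type_eq 1 s hs1 (by omega)).trans
            (H.type_eq (s - 1) s (by omega) (by omega)).symm) ha hb hab
      exact ReflTransGen.mono (B.step_mono le_rfl (hst'.trans ht0)) _ _ this
    · have : ReflTransGen (B.step A (p t) (p (min m (t + 1)))) a b := by
        rcases ht.eq_or_lt with rfl | ht1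
        · simpa using hab
        · have hmin : min m (t + 1) = t + 1 := by omega
          rw [hmin]
          exact B.right_conn_of_connType_eq ((H.type_eq t m ht1 (by omega)).trans
            (H.type_eq t (t + 1) (by omega) (by omega)).symm) ha hb hab
      exact ReflTransGen.mono (B.step_mono (hs0.trans hst') le_rfl) _ _ this

/-- The non-persistent vertices between the cuts `1` and `m`. -/
def middle (_ : B.Homogeneous e m p) : Set V :=
  {v | B.lab v ∉ B.persistent (p 0) (p 1) ∧ v ∈ B.span (p 1) (p m)}

/-- A vertex also present at or beyond an outer cut would lie on two consecutive cuts and so have a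
persistent label. -/
theorem middle_subset_inner (H : B.Homogeneous e m p) (hm : 1 ≤ m) :
    H.middle ⊆ B.inner (p 0) (p (m + 1)) := by
  rintro v ⟨hA, t, h1, h2, hv⟩ t' hv'
  constructor <;> by_contra! hlt
  · have h01 := H.lt 0 1 (by omega) (by omega)
    exact hA (H.lab_mem Nat.zero_lt_one (by omega) (B.interval hlt (h01.le.trans h1) hv' hv)
      (B.interval (hlt.trans h01.le) h1 hv' hv))
  · have hmm := H.lt m (m + 1) (by omega) (by omega)
    exact hA (H.lab_mem (Nat.lt_succ_self m) le_rfl (B.interval h2 (hmm.le.trans hlt) hv hv')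
      (B.interval (h2.trans hmm.le) hlt hv hv'))

/-- Position of a vertex relative to the cuts: `2 * s` for the vertices of the `s`-th cut, and
`2 * q + 1` for those strictly between the cuts `q` and `q + 1`. -/
def IsPos (_ : B.Homogeneous e m p) (v : V) (n : ℕ) : Prop :=
  (∃ s, 1 ≤ s ∧ s ≤ m ∧ n = 2 * s ∧ v ∈ B.bag (p s)) ∨
    ∃ q, 1 ≤ q ∧ q < m ∧ n = 2 * q + 1 ∧ v ∈ B.inner (p q) (p (q + 1))

theorem exists_isPos (H : B.Homogeneous e m p) {v : V} (hv : v ∈ H.middle) :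
    ∃ n, H.IsPos v n := by
  obtain ⟨hA, t, h1, h2, hv⟩ := hv
  by_cases hcut : ∃ s, 1 ≤ s ∧ s ≤ m ∧ v ∈ B.bag (p s)
  · obtain ⟨s, hs, hs', hvs⟩ := hcut
    exact ⟨_, .inl ⟨s, hs, hs', rfl, hvs⟩⟩
  · push Not at hcut
    have key : ∀ n, 1 ≤ n → n ≤ m → t ≤ p n → ∃ q, 1 ≤ q ∧ q < n ∧ p q < t ∧ t < p (q + 1) := by
      intro n hn
      induction n, hn using Nat.le_induction with
      | base =>
        intro h h'
        have : t = p 1 := by omega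
        exact absurd (this ▸ hv) (hcut 1 le_rfl h)
      | succ n hn ih =>
        intro h h'
        have hne : t ≠ p (n + 1) := fun h' => hcut (n + 1) (by omega) h (h' ▸ hv)
        rcases lt_or_ge (p n) t with h3 | h3
        · exact ⟨n, hn, by omega, h3, by omega⟩
        · obtain ⟨q, h4, h5, h6⟩ := ih (by omega) h3
          exact ⟨q, h4, by omega, h6⟩
    have hm : 1 ≤ m := by
      by_contra! hm
      obtain rfl : m = 0 := by omega
      have := H.lt 0 1 (by omega) (by omega)
      omega
    obtain ⟨q, hq, hqm, h3, h4⟩ := key m hm le_rfl h2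
    refine ⟨_, .inr ⟨q, hq, hqm, rfl, fun t' hv' => ?_⟩⟩
    constructor <;> by_contra! hlt
    · exact hcut q hq hqm.le (B.interval hlt h3.le hv' hv)
    · exact hcut (q + 1) (by omega) hqm (B.interval h4.le hlt hv hv')

theorem IsPos.range {H : B.Homogeneous e m p} {v : V} {n : ℕ} (h : H.IsPos v n) :
    2 ≤ n ∧ n ≤ 2 * m := by
  rcases h with ⟨s, h1, h2, rfl, -⟩ | ⟨q, h1, h2, rfl, -⟩ <;> omega

theorem IsPos.le_of_bag {H : B.Homogeneous e m p} {v : V} {n : ℕ} (h : H.IsPos v n)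
    (hv : v ∈ H.middle) {s t : ℕ} (ht : v ∈ B.bag t) (hts : t ≤ p s) :
    n ≤ 2 * s := by
  rcases h with ⟨s', h1, h2, rfl, h3⟩ | ⟨q, h1, h2, rfl, h3⟩
  · by_contra! hlt
    have hss : s < s' := by omega
    have := H.le hss.le (by omega)
    exact hv.1 (H.lab_mem hss (by omega) (B.interval hts this ht h3) h3)
  · by_contra! hlt
    have := H.le (s := s) (t := q) (by omega) (by omega)
    have := (h3 t ht).1
    omega

theorem IsPos.ge_of_bag {H : B.Homogeneous e m p} {v : V} {n : ℕ} (h : H.IsPos v n)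
    (hv : v ∈ H.middle) {s t : ℕ} (hs : s ≤ m + 1) (ht : v ∈ B.bag t) (hts : p s ≤ t) :
    2 * s ≤ n := by
  rcases h with ⟨s', h1, h2, rfl, h3⟩ | ⟨q, h1, h2, rfl, h3⟩
  · by_contra! hlt
    have hss : s' < s := by omega
    have := H.le hss.le (by omega)
    exact hv.1 (H.lab_mem hss (by omega) h3 (B.interval this hts h3 ht))
  · by_contra! hlt
    have := H.le (s := q + 1) (t := s) (by omega) (by omega)
    have := (h3 t ht).2
    omega

theorem IsPos.exists_bag_le {H : B.Homogeneous e m p} {v : V} {n : ℕ} (h : H.IsPos v n)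
    {s : ℕ} (hs : s ≤ m + 1) (hn : n ≤ 2 * s) : ∃ t ≤ p s, v ∈ B.bag t := by
  rcases h with ⟨s', h1, h2, rfl, h3⟩ | ⟨q, h1, h2, rfl, h3⟩
  · exact ⟨p s', H.le (by omega) hs, h3⟩
  · obtain ⟨t, ht⟩ := B.vertex_mem v
    exact ⟨t, (h3 t ht).2.le.trans (H.le (by omega) hs), ht⟩

theorem IsPos.exists_bag_ge {H : B.Homogeneous e m p} {v : V} {n : ℕ} (h : H.IsPos v n)
    {s : ℕ} (hn : 2 * s ≤ n) : ∃ t ≥ p s, v ∈ B.bag t := by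
  rcases h with ⟨s', h1, h2, rfl, h3⟩ | ⟨q, h1, h2, rfl, h3⟩
  · exact ⟨p s', H.le (by omega) (by omega), h3⟩
  · obtain ⟨t, ht⟩ := B.vertex_mem v
    exact ⟨t, (H.le (by omega) (by omega)).trans (h3 t ht).1.le, ht⟩

theorem IsPos.mem_span {H : B.Homogeneous e m p} {v : V} {n : ℕ} (h : H.IsPos v n)
    {s t : ℕ} (hst : s ≤ t) (ht : t ≤ m + 1) (hs : 2 * s ≤ n) (hn : n ≤ 2 * t) :
    v ∈ B.span (p s) (p t) := by
  obtain ⟨i, hi, hvi⟩ := h.exists_bag_ge hs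
  obtain ⟨j, hj, hvj⟩ := h.exists_bag_le ht hn
  rcases le_total i (p t) with h1 | h1
  · exact ⟨i, hi, h1, hvi⟩
  · exact ⟨p t, H.le hst ht, le_rfl, B.interval hj h1 hvj hvi⟩

/-- A vertex lying on two different cuts is persistent, hence outside `middle`; and a vertex
strictly between two cuts lies on none. -/
theorem IsPos.unique {H : B.Homogeneous e m p} {v : V} {n n' : ℕ} (hv : v ∈ H.middle)
    (h : H.IsPos v n) (h' : H.IsPos v n') : n = n' := by
  have key : ∀ {n n'}, H.IsPos v n → H.IsPos v n' → n ≤ n' := by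
    intro n n' h h'
    rcases h' with ⟨s, h1, h2, rfl, h3⟩ | ⟨q, h1, h2, rfl, h3⟩
    · exact h.le_of_bag hv h3 le_rfl
    · obtain ⟨t, ht⟩ := B.vertex_mem v
      have h4 := h.le_of_bag hv (s := q + 1) ht (h3 t ht).2.le
      by_contra! hlt
      obtain rfl : n = 2 * (q + 1) := by omega
      rcases h with ⟨s, -, -, h6, h7⟩ | ⟨_, -, -, h6, -⟩
      · obtain rfl : s = q + 1 := by omega
        exact lt_irrefl _ (h3 _ h7).2
      · omega
  exact le_antisymm (key h h') (key h' h)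

theorem inner_subset_middle (H : B.Homogeneous e m p) {q : ℕ} (hq : 1 ≤ q) (hqm : q < m) :
    B.inner (p q) (p (q + 1)) ⊆ H.middle := by
  intro v hv
  obtain ⟨t, ht⟩ := B.vertex_mem v
  have h1 := H.le hq (by omega)
  have h2 := H.le (s := q + 1) (t := m) (by omega) (by omega)
  have h3 := H.le (s := 0) (t := q) (by omega) (by omega)
  have h4 := H.le (s := q + 1) (t := m + 1) (by omega) (by omega)
  refine ⟨fun hA => ?_, t, h1.trans (hv t ht).1.le, (hv t ht).2.le.trans h2, ht⟩
  have := H.mem_bag ⟨t, h3.trans (hv t ht).1.le, (hv t ht).2.le.trans h4, ht⟩ hA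
    (s := q) (by omega)
  exact lt_irrefl _ (hv _ this).1

theorem step_of_adj (H : B.Homogeneous e m p) (hm : 1 ≤ m) {a b : V} (ha : a ∈ H.middle)
    (hb : b ∈ H.middle) (h : G.Adj a b) : B.step (B.persistent (p 0) (p 1)) (p 1) (p m) a b := by
  obtain ⟨t, hat, hbt⟩ := B.edge_mem a b h
  refine ⟨h, ha.1, hb.1, ?_⟩
  obtain ⟨-, i, hi, hi', hai⟩ := ha
  obtain ⟨-, j, hj, hj', hbj⟩ := hb
  have h1m := H.le hm (Nat.le_succ m)
  rcases le_total t (p 1) with h1 | h1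
  · exact ⟨p 1, le_rfl, h1m, B.interval h1 hi hat hai, B.interval h1 hj hbt hbj⟩
  rcases le_total t (p m) with h2 | h2
  · exact ⟨t, h1, h2, hat, hbt⟩
  · exact ⟨p m, h1m, le_rfl, B.interval hi' h2 hai hat, B.interval hj' h2 hbj hbt⟩

theorem guidedElim_middle [Finite V] {K : Type} (H : B.Homogeneous e m p) (hm : 1 ≤ m)
    (E : ∀ q ≤ m, Nonempty (GuidedElim G K (B.inner (p q) (p (q + 1))))) :
    Nonempty (GuidedElim G (K ⊕ (Fin 5 × Fin l)) H.middle) := by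
  have hpos : ∀ v, ∃ n, v ∈ H.middle → H.IsPos v n := by
    intro v
    by_cases hv : v ∈ H.middle
    · obtain ⟨n, hn⟩ := H.exists_isPos hv
      exact ⟨n, fun _ => hn⟩
    · exact ⟨0, fun h => absurd h hv⟩
  choose pos hpos using hpos
  have E' : ∀ q : ℕ, Nonempty (GuidedElim G K {v | v ∈ H.middle ∧ pos v = 2 * q + 1}) := by
    intro q
    by_cases hq : 1 ≤ q ∧ q < m
    · have : {v | v ∈ H.middle ∧ pos v = 2 * q + 1} = B.inner (p q) (p (q + 1)) := by
        ext v
        constructor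
        · rintro ⟨hv, hvq⟩
          have := hpos v hv
          rw [hvq] at this
          rcases this with ⟨s, -, -, h, -⟩ | ⟨q', -, -, h, hq'⟩
          · omega
          · obtain rfl : q = q' := by omega
            exact hq'
        · intro hv
          have hvm := H.inner_subset_middle hq.1 hq.2 hv
          exact ⟨hvm, (hpos v hvm).unique hvm (.inr ⟨q, hq.1, hq.2, rfl, hv⟩)⟩
      rw [this]
      exact E q hq.2.le
    · have : {v | v ∈ H.middle ∧ pos v = 2 * q + 1} = ∅ := by
        ext v
        simp only [Set.mem_ofPred_eq, Set.mem_empty_iff_false, iff_false, not_and]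
        intro hv hvq
        have := (hpos v hv).range
        omega
      rw [this]
      exact GuidedElim.of_isEmpty G K
  have hcut : ∀ v ∈ H.middle, ∀ s, pos v = 2 * s → v ∈ B.bag (p s) := by
    intro v hv s hs
    have := hpos v hv
    rw [hs] at this
    rcases this with ⟨s', -, -, h, h'⟩ | ⟨q', -, -, h, -⟩
    · obtain rfl : s = s' := by omega
      exact h'
    · omega
  refine GuidedElim.glue_linear pos B.lab (fun q => (E' q).some) ?_ ?_ ?_
  · rintro v hv w hw ⟨s, hs⟩ hvw hlab
    exact B.lab_inj (p s) (hcut v hv s (by omega)) (hcut w hw s (by omega)) hlab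
  · intro v hv w hw hvw hle
    obtain ⟨t, hvt, hwt⟩ := B.edge_mem v w hvw
    have hwr := (hpos w hw).range
    rcases hpos v hv with ⟨s, h1, h2, h3, h4⟩ | ⟨q, h1, h2, h3, h4⟩
    · by_contra! hcon
      have hev : Even (pos v) := ⟨s, by omega⟩
      have hgt := hcon.2 hev
      have hsm : s + 1 ≤ m := by omega
      rcases le_total t (p (s + 1)) with h | h
      · have := (hpos w hw).le_of_bag hw (s := s + 1) hwt h
        omega
      · have := (hpos v hv).ge_of_bag hv (s := s + 1) (by omega) hvt h
        omega
    · left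
      have := (hpos w hw).le_of_bag hw (s := q + 1) hwt (h4 t hvt).2.le
      omega
  · intro v hv x hx hex hnear hvx
    have hvr := (hpos v hv).range
    have hxr := (hpos x hx).range
    obtain ⟨a, ha⟩ := hex
    -- Cuts `s` and `t ≤ s + 1` enclose both vertices. One further interval on either side gives
    -- positions from `2 * s - 2` to `2 * t + 2`, all within 4 of `pos x`.
    obtain ⟨s, t, hs, hst, ht, hts, h1, h2, h3, h4⟩ : ∃ s t, 1 ≤ s ∧ s ≤ t ∧ t ≤ m ∧ t ≤ s + 1 ∧
        2 * s ≤ pos v ∧ 2 * s ≤ pos x ∧ pos v ≤ 2 * t ∧ pos x ≤ 2 * t :=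
      ⟨min (pos v) (pos x) / 2, (max (pos v) (pos x) + 1) / 2, by omega, by omega, by omega,
        by rcases hnear with h | ⟨⟨b, hb⟩, h⟩ <;> omega, by omega, by omega, by omega, by omega⟩
    have hstep : ReflTransGen (B.step (B.persistent (p 0) (p 1)) (p 1) (p m)) v x :=
      ReflTransGen.mono (fun a b hab => H.step_of_adj hm hab.2.1 hab.2.2 hab.1) _ _ hvx
    have hloc := H.local_conn hs hst ht ((hpos v hv).mem_span hst (by omega) h1 h3)
      ((hpos x hx).mem_span hst (by omega) h2 h4) hstep
    refine ReflTransGen.mono (fun a b hab => ?_) _ _ hloc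
    have hlow : p 1 ≤ p (max 1 (s - 1)) := H.le (by omega) (by omega)
    have hhigh : p (min m (t + 1)) ≤ p m := H.le (by omega) (by omega)
    obtain ⟨hab, hla, hlb, i, hi, hi', hai, hbi⟩ := hab
    have key : ∀ c, B.lab c ∉ B.persistent (p 0) (p 1) → c ∈ B.bag i →
        c ∈ {w | w ∈ H.middle ∧ pos w ≤ pos x + 4 ∧ pos x ≤ pos w + 4} := by
      intro c hc hci
      have hcm : c ∈ H.middle := ⟨hc, i, hlow.trans hi, hi'.trans hhigh, hci⟩
      have h5 := (hpos c hcm).le_of_bag hcm hci hi'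
      have h6 := (hpos c hcm).ge_of_bag hcm (by omega) hci hi
      exact ⟨hcm, by omega, by omega⟩
    exact ⟨hab, key a hla hai, key b hlb hbi⟩

end Homogeneous

/-! ### Combining intervals -/

theorem ncard_bag_le [Finite V] (t : ℕ) : (B.bag t).ncard ≤ l := by
  have := Set.ncard_le_ncard_of_injOn B.lab (t := Set.univ) (fun _ _ => trivial) (B.lab_inj t)
  simpa [Set.ncard_univ] using this

theorem before_or_after {v : V} {i : ℕ} (h : v ∉ B.bag i) :
    (∀ t, v ∈ B.bag t → t < i) ∨ ∀ t, v ∈ B.bag t → i < t := by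
  by_contra! hcon
  obtain ⟨⟨t, ht, hit⟩, t', ht', hti⟩ := hcon
  exact h (B.interval hti hit ht' ht)

/-- The bag at `j` separates the two interiors, and its at most `l` vertices are the ones added. -/
theorem guidedElim_binary [Finite V] {K : Type} {i j k : ℕ} (hij : i < j) (hjk : j < k)
    (E₁ : Nonempty (GuidedElim G K (B.inner i j))) (E₂ : Nonempty (GuidedElim G K (B.inner j k))) :
    Nonempty (GuidedElim G (K ⊕ Fin l) (B.inner i k)) := by
  refine GuidedElim.add_bounded (ι := Bool) (Y := B.bag j ∩ B.inner i k)
    (D := fun b => cond b (B.inner i j) (B.inner j k))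
    (fun b => by cases b; exacts [E₂.some, E₁.some]) ?_ ?_ ?_ ?_ ?_ ?_
  · have key : ∀ v, v ∈ B.inner i j → v ∈ B.inner j k → False := by
      intro v h h'
      obtain ⟨t, ht⟩ := B.vertex_mem v
      have := (h t ht).2
      have := (h' t ht).1
      omega
    rintro (_ | _) (_ | _) v h h'
    · rfl
    · exact (key v h' h).elim
    · exact (key v h h').elim
    · rfl
  · rintro (_ | _) v h t ht
    · exact ⟨hij.trans (h t ht).1, (h t ht).2⟩
    · exact ⟨(h t ht).1, (h t ht).2.trans hjk⟩
  · exact fun v h => h.2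
  · intro v hv hvY
    have hvj : v ∉ B.bag j := fun h => hvY ⟨h, hv⟩
    rcases B.before_or_after hvj with h | h
    · exact ⟨true, fun t ht => ⟨(hv t ht).1, h t ht⟩⟩
    · exact ⟨false, fun t ht => ⟨h t ht, (hv t ht).2⟩⟩
  · have key : ∀ v w, v ∈ B.inner i j → w ∈ B.inner j k → ¬ G.Adj v w := by
      intro v w hv hw h
      obtain ⟨t, ht, ht'⟩ := B.edge_mem v w h
      have := (hv t ht).2
      have := (hw t ht').1
      omega
    rintro (_ | _) (_ | _) v w hv hw - - hvw
    · rfl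
    · exact (key w v hw hv hvw.symm).elim
    · exact (key v w hv hw hvw).elim
    · rfl
  · exact (Set.ncard_le_ncard Set.inter_subset_left (Set.toFinite _)).trans (B.ncard_bag_le j)

/-- Three pieces, the two end intervals and `middle`, are separated by the cuts `1` and `m`. Adding
those two cuts costs at most `l + l` colors on top of the windowed ones. -/
theorem guidedElim_homogeneous [Finite V] {K : Type} {e : ConnType l} {m : ℕ} {p : ℕ → ℕ}
    (H : B.Homogeneous e m p) (hm : 1 ≤ m)
    (E : ∀ q ≤ m, Nonempty (GuidedElim G K (B.inner (p q) (p (q + 1))))) :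
    Nonempty (GuidedElim G ((K ⊕ (Fin 5 × Fin l)) ⊕ Fin (l + l)) (B.inner (p 0) (p (m + 1)))) := by
  have E₀ := (E 0 (by omega)).some.map_colors (.inl : K ↪ K ⊕ (Fin 5 × Fin l))
  have E₁ := (E m le_rfl).some.map_colors (.inl : K ↪ K ⊕ (Fin 5 × Fin l))
  have E₂ := H.guidedElim_middle hm E
  have h01 := H.lt 0 1 (by omega) (by omega)
  have h1m := H.le (s := 1) (t := m) (by omega) (by omega)
  have hmm := H.lt m (m + 1) (by omega) (by omega)
  let D : Option Bool → Set V := fun q => match q with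
    | none => H.middle
    | some false => B.inner (p 0) (p 1)
    | some true => B.inner (p m) (p (m + 1))
  have hdis1 : ∀ v, v ∈ H.middle → v ∈ B.inner (p 0) (p 1) → False := by
    rintro v ⟨-, t, h1, h2, ht⟩ h
    exact absurd (h t ht).2 (by omega)
  have hdis2 : ∀ v, v ∈ H.middle → v ∈ B.inner (p m) (p (m + 1)) → False := by
    rintro v ⟨-, t, h1, h2, ht⟩ h
    exact absurd (h t ht).1 (by omega)
  have hdis3 : ∀ v, v ∈ B.inner (p 0) (p 1) → v ∈ B.inner (p m) (p (m + 1)) → False := by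
    intro v h h'
    obtain ⟨t, ht⟩ := B.vertex_mem v
    have := (h t ht).2
    have := (h' t ht).1
    omega
  have hsub := H.middle_subset_inner hm
  -- `Y` may meet `middle`: gluing requires the pieces to be disjoint from each other, not from `Y`.
  set Y : Set V := (B.bag (p 1) ∪ B.bag (p m)) ∩ B.inner (p 0) (p (m + 1)) with hY
  have hadj1 : ∀ v w, v ∈ H.middle → w ∈ B.inner (p 0) (p 1) → v ∉ Y → ¬ G.Adj v w := by
    rintro v w hv hw hvY h
    obtain ⟨t, ht, ht'⟩ := B.edge_mem v w h
    obtain ⟨i, hi, -, hvi⟩ := hv.2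
    exact hvY ⟨.inl (B.interval (hw t ht').2.le hi ht hvi), hsub hv⟩
  have hadj2 : ∀ v w, v ∈ H.middle → w ∈ B.inner (p m) (p (m + 1)) → v ∉ Y → ¬ G.Adj v w := by
    rintro v w hv hw hvY h
    obtain ⟨t, ht, ht'⟩ := B.edge_mem v w h
    obtain ⟨i, -, hi, hvi⟩ := hv.2
    exact hvY ⟨.inr (B.interval hi (hw t ht').1.le hvi ht), hsub hv⟩
  have hadj3 : ∀ v w, v ∈ B.inner (p 0) (p 1) → w ∈ B.inner (p m) (p (m + 1)) → ¬ G.Adj v w := by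
    intro v w hv hw h
    obtain ⟨t, ht, ht'⟩ := B.edge_mem v w h
    have := (hv t ht).2
    have := (hw t ht').1
    omega
  refine GuidedElim.add_bounded (ι := Option Bool) (Y := Y) (D := D)
    (fun q => match q with
      | none => E₂.some
      | some false => E₀.some
      | some true => E₁.some) ?_ ?_ ?_ ?_ ?_ ?_
  · rintro (_ | _ | _) (_ | _ | _) v h h'
    · rfl
    · exact (hdis1 v h h').elim
    · exact (hdis2 v h h').elim
    · exact (hdis1 v h' h).elim
    · rfl
    · exact (hdis3 v h h').elim
    · exact (hdis2 v h' h).elim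
    · exact (hdis3 v h' h).elim
    · rfl
  · rintro (_ | _ | _) v h
    · exact hsub h
    · exact fun t ht => ⟨(h t ht).1, (h t ht).2.trans_le (h1m.trans hmm.le)⟩
    · exact fun t ht => ⟨(h01.le.trans h1m).trans_lt (h t ht).1, (h t ht).2⟩
  · exact fun v h => h.2
  · intro v hv hvY
    have hv1 : v ∉ B.bag (p 1) := fun h => hvY ⟨.inl h, hv⟩
    have hvm : v ∉ B.bag (p m) := fun h => hvY ⟨.inr h, hv⟩
    rcases B.before_or_after hv1 with h | h
    · exact ⟨some false, fun t ht => ⟨(hv t ht).1, h t ht⟩⟩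
    rcases B.before_or_after hvm with h' | h'
    · refine ⟨none, ?_, ?_⟩
      · obtain ⟨t, ht⟩ := B.vertex_mem v
        exact fun hA => hv1 (H.mem_bag ⟨t, (hv t ht).1.le, (hv t ht).2.le, ht⟩ hA (by omega))
      · obtain ⟨t, ht⟩ := B.vertex_mem v
        exact ⟨t, (h t ht).le, (h' t ht).le, ht⟩
    · exact ⟨some true, fun t ht => ⟨h' t ht, (hv t ht).2⟩⟩
  · rintro (_ | _ | _) (_ | _ | _) v w hv hw hvY hwY hvw
    · rfl
    · exact (hadj1 v w hv hw hvY hvw).elim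
    · exact (hadj2 v w hv hw hvY hvw).elim
    · exact (hadj1 w v hw hv hwY hvw.symm).elim
    · rfl
    · exact (hadj3 v w hv hw hvw).elim
    · exact (hadj2 w v hw hv hwY hvw.symm).elim
    · exact (hadj3 w v hw hv hvw.symm).elim
    · rfl
  · refine (Set.ncard_le_ncard Set.inter_subset_left (Set.toFinite _)).trans ?_
    exact (Set.ncard_union_le _ _).trans (add_le_add (B.ncard_bag_le _) (B.ncard_bag_le _))

end LabeledBags

/-! ### Closure under factorization -/

theorem GuidedElim.recolor {K K' : Type} [Fintype K] [Fintype K'] {U : Set V}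
    (h : Fintype.card K ≤ Fintype.card K') (E : Nonempty (GuidedElim G K U)) :
    Nonempty (GuidedElim G K' U) :=
  E.some.map_colors (Function.Embedding.nonempty_of_card_le h).some

theorem transGen_exists_seq {α : Type*} {Q : α → α → Prop} {i j : α} (h : TransGen Q i j) :
    ∃ (m : ℕ) (p : ℕ → α), p 0 = i ∧ p (m + 1) = j ∧ ∀ s ≤ m, Q (p s) (p (s + 1)) := by
  induction h with
  | @single j h =>
    refine ⟨0, fun s => if s = 0 then i else j, by simp, by simp, fun s hs => ?_⟩
    obtain rfl : s = 0 := by omega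
    simpa using h
  | @tail j k _ h ih =>
    obtain ⟨m, p, h0, h1, h2⟩ := ih
    refine ⟨m + 1, fun s => if s ≤ m + 1 then p s else k, by simpa using h0, by simp,
      fun s hs => ?_⟩
    rcases hs.eq_or_lt with rfl | hs
    · simpa [h1] using h
    · have h3 : s ≤ m + 1 := by omega
      have h4 : s + 1 ≤ m + 1 := by omega
      simp only [h3, h4, if_true]
      exact h2 s (by omega)

namespace LabeledBags

variable {l : ℕ} (B : LabeledBags G l)

/-- The color budget grows by `5 * l + (l + l)` per round: exactly the cost of an idempotent chain,
while a binary product needs only `l`. -/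
theorem factorizationClosed [Finite V] : FactorizationClosed B.connType fun h i j =>
    i < j ∧ Nonempty (GuidedElim G (Fin (h * (5 * l + (l + l)))) (B.inner i j)) where
  lt h i j H := H.1
  succ h i j H := ⟨H.1, GuidedElim.recolor (by simp only [Fintype.card_fin]; gcongr; omega) H.2⟩
  binary h i j k H₁ H₂ := by
    refine ⟨H₁.1.trans H₂.1, GuidedElim.recolor ?_ (B.guidedElim_binary H₁.1 H₂.1 H₁.2 H₂.2)⟩
    simp only [Fintype.card_fin, Fintype.card_sum]
    rw [add_mul]
    omega
  idem h e i j he hch := by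
    obtain ⟨m, p, rfl, rfl, hp⟩ := transGen_exists_seq hch
    have H : B.Homogeneous e m p := by
      have key : ∀ s t, s < t → t ≤ m + 1 → p s < p t ∧ B.connType (p s) (p t) = e := by
        intro s t hst
        induction t, hst using Nat.le_induction with
        | base =>
          intro ht
          have := hp s (by omega)
          exact ⟨this.1.1, this.2⟩
        | succ t hst ih =>
          intro ht
          have h1 := ih (by omega)
          have h2 := hp t (by omega)
          refine ⟨h1.1.trans h2.1.1, ?_⟩
          rw [B.connType_additive _ _ _ h1.1 h2.1.1, h1.2, h2.2, he]
      exact ⟨fun s t h h' => (key s t h h').1, fun s t h h' => (key s t h h').2⟩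
    refine ⟨H.lt _ _ (by omega) le_rfl, ?_⟩
    -- For `m = 0` the chain is a single interval and has no interior cut.
    rcases Nat.eq_zero_or_pos m with rfl | hm
    · refine GuidedElim.recolor ?_ (hp 0 le_rfl).1.2
      simp only [Fintype.card_fin]
      gcongr
      omega
    · refine GuidedElim.recolor ?_
        (B.guidedElim_homogeneous H hm fun q hq => (hp q hq).1.2)
      simp only [Fintype.card_fin, Fintype.card_sum, Fintype.card_prod]
      rw [add_mul]
      omega

end LabeledBags

/-! ### Labelling a path decomposition -/

/-- The vertices of an interval representation of clique number at most `l` can be labelled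
by `l` labels, injectively on every bag. -/
theorem exists_injOn_labels [Finite V] {l : ℕ} (hl : 0 < l) (bag : ℕ → Set V)
    (hcard : ∀ t, (bag t).ncard ≤ l)
    (hint : ∀ {i j k : ℕ} {v : V}, i ≤ j → j ≤ k → v ∈ bag i → v ∈ bag k → v ∈ bag j) (N : ℕ) :
    ∃ lab : V → Fin l, ∀ t < N, Set.InjOn lab (bag t) := by
  classical
  induction N with
  | zero => exact ⟨fun _ => ⟨0, hl⟩, by simp⟩
  | succ N ih =>
    obtain ⟨lab, hlab⟩ := ih
    set O : Set V := {v | ∃ t < N, v ∈ bag t} with hO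
    have hold : Set.InjOn lab (bag N ∩ O) := by
      rintro v ⟨hv, t, ht, hvt⟩ w ⟨hw, t', ht', hwt⟩ h
      -- Vertices of bag `N` seen earlier all lie in bag `N - 1`, so their labels already differ;
      -- only new vertices get fresh labels.
      exact hlab (N - 1) (by omega) (hint (by omega) (by omega) hvt hv)
        (hint (by omega) (by omega) hwt hw) h
    have hle : (bag N \ O).ncard ≤ ((lab '' (bag N ∩ O))ᶜ : Set (Fin l)).ncard := by
      have h1 := Set.ncard_add_ncard_compl (lab '' (bag N ∩ O))
      rw [hold.ncard_image, Nat.card_eq_fintype_card, Fintype.card_fin] at h1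
      have h2 := Set.ncard_inter_add_ncard_sdiff_eq_ncard (bag N) O (Set.toFinite _)
      have := hcard N
      omega
    have := Fintype.ofFinite ↥(bag N \ O)
    rw [← Nat.card_coe_set_eq, ← Nat.card_coe_set_eq, Nat.card_eq_fintype_card,
      Nat.card_eq_fintype_card] at hle
    obtain ⟨f⟩ := Function.Embedding.nonempty_of_card_le hle
    refine ⟨fun v => if h : v ∈ bag N \ O then f ⟨v, h⟩ else lab v, fun t ht => ?_⟩
    rcases Nat.lt_succ_iff_lt_or_eq.1 ht with ht | rfl
    · have hO' : ∀ v ∈ bag t, v ∉ bag N \ O := fun v hv h => h.2 ⟨t, ht, hv⟩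
      intro v hv w hw h
      simp only [hO' v hv, hO' w hw, dite_false] at h
      exact hlab t ht hv hw h
    · have hnew : ∀ (v w : V) (h : v ∈ bag t \ O), w ∈ bag t ∩ O → (f ⟨v, h⟩ : Fin l) ≠ lab w :=
        fun v w h hw heq => (f ⟨v, h⟩).2 ⟨w, hw, heq.symm⟩
      intro v hv w hw h
      by_cases hvO : v ∈ O <;> by_cases hwO : w ∈ O
      · simp only [Set.mem_sdiff, hvO, hwO, not_true, and_false, dite_false] at h
        exact hold ⟨hv, hvO⟩ ⟨hw, hwO⟩ h
      · have hw' : w ∈ bag t \ O := ⟨hw, hwO⟩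
        have hv' : v ∉ bag t \ O := fun h => h.2 hvO
        simp only [hw', hv', dite_true, dite_false] at h
        exact absurd h.symm (hnew w v hw' ⟨hv, hvO⟩)
      · have hv' : v ∈ bag t \ O := ⟨hv, hvO⟩
        have hw' : w ∉ bag t \ O := fun h => h.2 hwO
        simp only [hw', hv', dite_true, dite_false] at h
        exact absurd h (hnew v w hv' ⟨hw, hwO⟩)
      · have hv' : v ∈ bag t \ O := ⟨hv, hvO⟩
        have hw' : w ∈ bag t \ O := ⟨hw, hwO⟩
        simp only [hw', hv', dite_true] at h
        simpa using f.injective (Subtype.ext h)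

theorem PathDecomposition.exists_labeledBags [Finite V] {k : ℕ} (P : PathDecomposition G)
    (hP : P.width ≤ k) : ∃ (B : LabeledBags G (k + 1)) (n : ℕ), B.inner 0 n = Set.univ ∧ 0 < n := by
  -- The shift by one leaves bag `0` and bag `P.length + 1` empty, so every vertex is strictly
  -- inside this interval.
  set bag : ℕ → Set V := fun t => {v | ∃ i : Fin P.length, (i : ℕ) + 1 = t ∧ v ∈ P.bag i} with hbag
  have hint : ∀ {i j k : ℕ} {v : V}, i ≤ j → j ≤ k → v ∈ bag i → v ∈ bag k → v ∈ bag j := by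
    rintro _ j _ v hij hjk ⟨a, rfl, ha⟩ ⟨b, rfl, hb⟩
    refine ⟨⟨j - 1, by omega⟩, by simp only; omega, ?_⟩
    exact P.interval a _ b v (Fin.le_def.2 (by simp only; omega))
      (Fin.le_def.2 (by simp only; omega)) ha hb
  have hcard : ∀ t, (bag t).ncard ≤ k + 1 := by
    intro t
    by_cases h : ∃ i : Fin P.length, (i : ℕ) + 1 = t
    · obtain ⟨i, rfl⟩ := h
      have hsub : bag (i + 1) ⊆ P.bag i := by
        rintro v ⟨j, hj, hv⟩
        obtain rfl : j = i := Fin.ext (by omega)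
        exact hv
      refine (Set.ncard_le_ncard hsub (Set.toFinite _)).trans ?_
      rw [Set.ncard_coe_finset]
      have h1 := Finset.le_sup (f := fun i => (P.bag i).card) (Finset.mem_univ i)
      unfold PathDecomposition.width at hP
      omega
    · have : bag t = ∅ := by
        ext v
        simp only [Set.mem_empty_iff_false, iff_false]
        rintro ⟨i, hi, -⟩
        exact h ⟨i, hi⟩
      simp [this]
  obtain ⟨lab, hlab⟩ := exists_injOn_labels (Nat.succ_pos k) bag hcard hint (P.length + 1)
  refine ⟨{ bag := bag
            vertex_mem := ?_
            edge_mem := ?_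
            interval := hint
            lab := lab
            lab_inj := ?_ }, P.length + 1, ?_, Nat.succ_pos _⟩
  · intro v
    obtain ⟨i, hi⟩ := P.vertex_mem v
    exact ⟨i + 1, i, rfl, hi⟩
  · intro v w hvw
    obtain ⟨i, hi, hi'⟩ := P.edge_mem v w hvw
    exact ⟨i + 1, ⟨i, rfl, hi⟩, i, rfl, hi'⟩
  · intro t
    by_cases ht : t < P.length + 1
    · exact hlab t ht
    · rintro v ⟨i, hi, -⟩
      omega
  · ext v
    simp only [Set.mem_univ, iff_true]
    rintro t ⟨i, rfl, -⟩
    omega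

end GuidedTW

/-! ### Conclusion -/

theorem mainTheorem3 :
    ∃ f : ℕ → ℕ, ∀ (V : Type*) [Finite V] (G : SimpleGraph V) (k : ℕ),
      GuidedTW.pathwidth G ≤ k →
        GuidedTW.guidedTreewidth G ≤ f k ∧
        ∃ (T : GuidedTW.TreeDecomposition G) (Λ : GuidedTW.GuidanceSystem G),
          T.width ≤ f k ∧ Λ.Colorable (f k) ∧ ∀ x : T.Node, Λ.Captures (T.bag x) := by
  choose N hN using fun k => GuidedTW.FactorizationClosed.bounded (GuidedTW.ConnType (k + 1))
  refine ⟨fun k => N k * (5 * (k + 1) + ((k + 1) + (k + 1))), fun V _ G k hk => ?_⟩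
  have hlt : GuidedTW.pathwidth G < ((k + 1 : ℕ) : ℕ∞) :=
    hk.trans_lt (by exact_mod_cast Nat.lt_succ_self k)
  obtain ⟨P, hP⟩ := iInf_lt_iff.1 hlt
  have hP : P.width ≤ k := Nat.lt_succ_iff.1 (by exact_mod_cast hP)
  obtain ⟨B, n, huniv, hn⟩ := P.exists_labeledBags hP
  -- No vertex occurs only strictly between `i` and `i + 1`, so height `0` starts from empty
  -- interiors with no colors.
  have hE := hN k _ _ B.connType_additive B.factorizationClosed (fun i => ⟨Nat.lt_succ_self i, by
    have : B.inner i (i + 1) = ∅ := by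
      ext v
      simp only [Set.mem_empty_iff_false, iff_false]
      intro hv
      obtain ⟨t, ht⟩ := B.vertex_mem v
      have := hv t ht
      omega
    rw [this]
    exact GuidedTW.GuidedElim.of_isEmpty G _⟩) 0 n hn
  rw [huniv] at hE
  obtain ⟨T, Λ, hT, hΛ, hcap⟩ := hE.2.some.exists_treeDecomposition
  exact ⟨iInf₂_le _ ⟨T, Λ, hΛ, hcap⟩, T, Λ, hT, hΛ, hcap⟩
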